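/- Let $n\ge 2$ and let $\Omega\subset\mathbb R^n$ be a bounded domain (nonempty, open, connected). Write $d(x):=\operatorname{dist}(x,\partial\Omega)$ and $\delta(x,z):=\min\{d(x),d(z)\}$ for $x,z\in\Omega$. Suppose that $\Omega$ is a John domain, that is, there are a point $x_0\in\Omega$, positive constants $\lambda,K,C_0$ and a family of rectifiable curves $\gamma(\cdot,y):[0,1]\to\Omega$, $y\in\Omega$, such that 1. $\gamma(0,y)=y$ and $\gamma(1,y)=x_0$ for all $y\in\Omega$; 2. $d(\gamma(t,y))\ge\lambda t$ for all $y\in\Omega$ and $t\in[0,1]$; 3. $|\dot\gamma(t,y)|\le K$, in the sense that $\gamma(\cdot,y)$ is Lipschitz on $[0,1]$ with constant $K$, for all $y\in\Omega$; 4. for all $x,y\in\Omega$ and $0<r\le\frac12 d(x)$, the part of the curve $\gamma([0,1],y)$ that lies in the ball $B(x,r)$ has length (one-dimensional Hausdorff measure) at most $C_0 r$. Let $s\in(0,1)$, $1\le q\le\frac{n}{n-s}$, $a\ge 0$ and $b\le\frac{n+a}{q}-n+s$. Then there is a constant $C>0$, depending only on $n,\Omega,s,q,a,b$, such that for every real-valued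 $f\in C^\infty(\Omega)$ $$ \inf_{c\in\mathbb R}\|f-c\|_{L^q(\Omega,d^a)}\le C\int_\Omega\int_{|x-z|\le d(x)/2}\frac{|f(z)-f(x)|}{|z-x|^{n+s}}\,\delta(x,z)^b\,dz\,dx , $$ where $\|g\|_{L^q(\Omega,d^a)}=\left(\int_\Omega|g(x)|^q\,d(x)^a\,dx\right)^{1/q}$ and both sides take values in $[0,\infty]$ (so if the right-hand side is finite, then $f\in L^q(\Omega,d^a)$). -/

import Mathlib

open MeasureTheory Set
open scoped ENNReal NNReal ContDiff

/-- `d(x) = dist(x, ∂Ω)`, the distance to the boundary (used at points `x ∈ Ω`). -/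
noncomputable def bdryDist {n : ℕ} (Ω : Set (EuclideanSpace ℝ (Fin n)))
    (x : EuclideanSpace ℝ (Fin n)) : ℝ :=
  Metric.infDist x (frontier Ω)

/-- `δ(x,z) = min {d(x), d(z)}`. -/
noncomputable def minBdryDist {n : ℕ} (Ω : Set (EuclideanSpace ℝ (Fin n)))
    (x z : EuclideanSpace ℝ (Fin n)) : ℝ :=
  min (bdryDist Ω x) (bdryDist Ω z)

/-- A bounded domain `Ω ⊆ ℝⁿ` is `β`-John if some base point `x₀ ∈ Ω` (the origin, after a
translation) can be joined to every `y ∈ Ω` by a curve `t ↦ γ y t` in `Ω` as below. The bound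
`|γ'| ≤ K` for the speed of the rectifiable curve is the Lipschitz condition, and the length of
the part of the curve in a ball is the one-dimensional Hausdorff measure of that set. -/
structure IsBetaJohnDomain {n : ℕ} (β : ℝ) (Ω : Set (EuclideanSpace ℝ (Fin n))) : Prop where
  isOpen : IsOpen Ω
  isConnected : IsConnected Ω
  isBounded : Bornology.IsBounded Ω
  exists_curves : ∃ x₀ ∈ Ω, ∃ γ : EuclideanSpace ℝ (Fin n) → ℝ → EuclideanSpace ℝ (Fin n),
    ∃ lam : ℝ, 0 < lam ∧ ∃ K : ℝ≥0, 0 < K ∧ ∃ C : ℝ, 0 < C ∧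
      (∀ y ∈ Ω, γ y 0 = y ∧ γ y 1 = x₀) ∧
      (∀ y ∈ Ω, ∀ t ∈ Icc (0 : ℝ) 1, γ y t ∈ Ω ∧ lam * t ^ β ≤ bdryDist Ω (γ y t)) ∧
      (∀ y ∈ Ω, LipschitzOnWith K (γ y) (Icc (0 : ℝ) 1)) ∧
      (∀ x ∈ Ω, ∀ y ∈ Ω, ∀ r : ℝ, 0 < r → r ≤ bdryDist Ω x / 2 →
        Measure.hausdorffMeasure 1 (γ y '' Icc (0 : ℝ) 1 ∩ Metric.ball x r) ≤
          ENNReal.ofReal (C * r))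

/-- A John domain is a `1`-John domain. -/
def IsJohnDomain {n : ℕ} (Ω : Set (EuclideanSpace ℝ (Fin n))) : Prop :=
  IsBetaJohnDomain 1 Ω

/-- The measure `d(x)^a dx` on `Ω`; `L^q(Ω, d^a)` is `L^q` of this measure. -/
noncomputable def distWeightMeasure {n : ℕ} (Ω : Set (EuclideanSpace ℝ (Fin n))) (a : ℝ) :
    Measure (EuclideanSpace ℝ (Fin n)) :=
  (volume.restrict Ω).withDensity fun x => ENNReal.ofReal (bdryDist Ω x ^ a)

/-- The weighted fractional seminorm with exponent `p = 1`,
`∫_Ω ∫_{|x-z| ≤ d(x)/2} |f(z) - f(x)| |z - x|^{-(n+s)} δ(x,z)^b dz dx`, with values in `[0,∞]`.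
The inner region is contained in `Ω` when `Ω` is open. -/
noncomputable def fracSeminormOne {n : ℕ} (Ω : Set (EuclideanSpace ℝ (Fin n))) (s b : ℝ)
    (f : EuclideanSpace ℝ (Fin n) → ℝ) : ℝ≥0∞ :=
  ∫⁻ x in Ω, ∫⁻ z in Metric.closedBall x (bdryDist Ω x / 2),
    ENNReal.ofReal (|f z - f x| / ‖z - x‖ ^ ((n : ℝ) + s) * minBdryDist Ω x z ^ b)

open Filter Topology Metric
open scoped Pointwise

/-! The inequality is reduced to an isoperimetric inequality for sets, as in the Maz'ya truncation
argument. Let `ν = d^a dx`, and let `B` be a fixed ball about the John centre with closure in `Ω`.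

Pointwise bound. Averaging `u` over balls of radius `ρ θ^k` centred on the John curve of `y` and
telescoping from `B` down to `y` bounds `|u(y) - u_B|` by a Riesz potential of order `s` of `d^(-b)
g`, where `g` is the inner integral of the seminorm. The ball at time `t` has radius and distance to
the boundary of at least order `t` and lies within order `t` of `y`, so only points `x` with `|x -
y| ≤ M d(x)` enter (`IsJohnDomain.exists_enorm_sub_average_le`).

Sets. For `u = 1_A`, where `A` fills at most half of `B`, the left side is at least `1/2` a.e. on
`A`. Integrating over `A` against `ν` and exchanging integrals leaves `∫_A |x - y|^(s-n) dν(y)` over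
`|x - y| ≤ M d(x)`, which is at most `C ν(A)^(1-1/q) d(x)^b` (`exists_lintegral_rieszKernel_le`).
Dividing by `ν(A)^(1-1/q)` gives `ν(A)^(1/q) ≤ C |1_A|`, with `|·|` the seminorm. Working with sets
reaches the endpoint `q = n/(n-s)`, where the Riesz potential is only of weak type on `L¹`.

Functions. With `c` a median of `f` on `B`, every superlevel set of `f - c` and of `c - f` at a
positive level is admissible. Minkowski's inequality bounds the `L^q` norm by the integral of
`ν(level set)^(1/q)`, and the seminorm, being linear in `|f(z) - f(x)|`, satisfies an exact coarea
formula. -/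

/-! ### Geometric sums and the Riesz kernel -/

lemma sum_pow_ite_le {w V : ℝ} (hw : 1 < w) (hV : 0 ≤ V) (N : ℕ) :
    ∑ k ∈ Finset.range N, (if w ^ k ≤ V then w ^ k else 0) ≤ w / (w - 1) * V := by
  have hw1 : 0 < w - 1 := by linarith
  induction N with
  | zero => simp; positivity
  | succ N ih =>
    by_cases h : w ^ N ≤ V
    · calc ∑ k ∈ Finset.range (N + 1), (if w ^ k ≤ V then w ^ k else 0)
          ≤ ∑ k ∈ Finset.range (N + 1), w ^ k := by
            refine Finset.sum_le_sum fun k _ => ?_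
            split_ifs
            · exact le_rfl
            · positivity
        _ = (w ^ (N + 1) - 1) / (w - 1) := geom_sum_eq hw.ne' _
        _ ≤ w / (w - 1) * V := by
            rw [div_mul_eq_mul_div]
            gcongr
            rw [pow_succ']
            nlinarith
    · rw [Finset.sum_range_succ, if_neg h, add_zero]
      exact ih

/-- The terms grow geometrically until `θ^k` falls below `τ / M`, so the sum is comparable to its
last nonzero term. This turns a sum over scales into a Riesz kernel. At `τ = 0` the right side is
`⊤`. -/
lemma tsum_geometric_kernel_le {θ p M : ℝ} (hθ : 0 < θ) (hθ1 : θ < 1) (hp : 0 < p) (hM : 0 < M) :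
    ∃ C : ℝ, 0 < C ∧ ∀ τ : ℝ, 0 ≤ τ →
      ∑' k : ℕ, (if τ ≤ M * θ ^ k then ENNReal.ofReal ((θ ^ k) ^ (-p)) else 0) ≤
        ENNReal.ofReal C * ENNReal.ofReal τ ^ (-p) := by
  set w : ℝ := θ ^ (-p) with hwdef
  have hw : 1 < w := Real.one_lt_rpow_of_pos_of_lt_one_of_neg hθ hθ1 (by linarith)
  have hw1 : 0 < w - 1 := by linarith
  have hCpos : 0 < w / (w - 1) * M ^ p := by positivity
  refine ⟨w / (w - 1) * M ^ p, hCpos, fun τ hτ => ?_⟩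
  rcases hτ.eq_or_lt with rfl | hτ
  · rw [ENNReal.ofReal_zero, ENNReal.zero_rpow_of_neg (by linarith), ENNReal.mul_top]
    · exact le_top
    · simpa using hCpos
  have hwk (k : ℕ) : (θ ^ k) ^ (-p) = w ^ k := by
    rw [hwdef, ← Real.rpow_natCast, ← Real.rpow_natCast, ← Real.rpow_mul hθ.le,
      ← Real.rpow_mul hθ.le, mul_comm]
  have hV : 0 ≤ (M / τ) ^ p := by positivity
  rw [ENNReal.tsum_eq_iSup_nat]
  refine iSup_le fun N => ?_
  calc ∑ k ∈ Finset.range N, (if τ ≤ M * θ ^ k then ENNReal.ofReal ((θ ^ k) ^ (-p)) else 0)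
      ≤ ∑ k ∈ Finset.range N, ENNReal.ofReal (if w ^ k ≤ (M / τ) ^ p then w ^ k else 0) := by
        refine Finset.sum_le_sum fun k _ => ?_
        split_ifs with h1 h2
        · rw [hwk]
        · refine absurd ?_ h2
          rw [← hwk, Real.rpow_neg (by positivity), ← Real.inv_rpow (by positivity)]
          refine Real.rpow_le_rpow (by positivity) ?_ hp.le
          rw [inv_eq_one_div, div_le_div_iff₀ (by positivity) hτ]
          linarith
        · exact zero_le
        · exact zero_le
    _ = ENNReal.ofReal (∑ k ∈ Finset.range N, if w ^ k ≤ (M / τ) ^ p then w ^ k else 0) := by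
        rw [ENNReal.ofReal_sum_of_nonneg]
        intro k _
        split_ifs <;> positivity
    _ ≤ ENNReal.ofReal (w / (w - 1) * (M / τ) ^ p) :=
        ENNReal.ofReal_le_ofReal (sum_pow_ite_le hw hV N)
    _ = ENNReal.ofReal (w / (w - 1) * M ^ p) * ENNReal.ofReal τ ^ (-p) := by
        rw [ENNReal.ofReal_rpow_of_pos hτ, ← ENNReal.ofReal_mul hCpos.le,
          Real.div_rpow hM.le hτ.le, Real.rpow_neg hτ.le]
        congr 1
        ring

lemma exists_lintegral_ball_edist_rpow {n : ℕ} (hn : 1 ≤ n) {s : ℝ} (hs : 0 < s) :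
    ∃ C : ℝ, 0 < C ∧ ∀ (x : EuclideanSpace ℝ (Fin n)) (R : ℝ), 0 < R →
      ∫⁻ y in ball x R, edist x y ^ (-((n : ℝ) - s)) ≤ ENNReal.ofReal (C * R ^ s) := by
  have hdim : Module.finrank ℝ (EuclideanSpace ℝ (Fin n)) = n := by simp
  have : Nonempty (Fin n) := ⟨⟨0, hn⟩⟩
  let φ : EuclideanSpace ℝ (Fin n) → ℝ := fun y => ‖y‖ ^ (-((n : ℝ) - s))
  have hφ0 : ∀ y, 0 ≤ φ y := fun y => by positivity
  have hφm : Measurable φ := by fun_prop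
  have hint (R : ℝ) : IntegrableOn φ (ball 0 R) := by
    refine integrableOn_ball_of_norm_le_rpow (C := 1) (α := (n : ℝ) - s) (by rw [hdim]; exact hn)
      (by rw [hdim]; linarith) (Eventually.of_forall fun y => ?_) hφm.aestronglyMeasurable
    rw [Real.norm_of_nonneg (hφ0 y), one_mul]
  -- The summand `1` makes the constant visibly positive.
  refine ⟨(∫ y in ball 0 1, φ y) + 1, ?_, fun x R hR => ?_⟩
  · have : 0 ≤ ∫ y in ball 0 1, φ y := integral_nonneg hφ0
    linarith
  have hscale := Measure.setIntegral_comp_smul_of_pos volume φ (ball (0 : EuclideanSpace ℝ (Fin n)) 1) hR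
  have hball : R • ball (0 : EuclideanSpace ℝ (Fin n)) 1 = ball 0 R := by
    rw [smul_unitBall hR.ne', Real.norm_of_nonneg hR.le]
  rw [hball, hdim] at hscale
  have h1 : ∫ y in ball 0 R, φ y = R ^ s * ∫ y in ball 0 1, φ y := by
    have h2 : ∫ y in ball 0 1, φ (R • y) = R ^ (-((n : ℝ) - s)) * ∫ y in ball 0 1, φ y := by
      rw [← integral_const_mul]
      congr 1 with y
      simp only [φ]
      rw [norm_smul, Real.norm_of_nonneg hR.le, Real.mul_rpow hR.le (norm_nonneg _)]
    rw [h2, smul_eq_mul, eq_inv_mul_iff_mul_eq₀ (by positivity), ← mul_assoc, ← Real.rpow_natCast,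
      ← Real.rpow_add hR] at hscale
    rw [← hscale]
    congr 2
    ring
  have htrans : ∫⁻ y in ball x R, edist x y ^ (-((n : ℝ) - s)) =
      ∫⁻ y in ball 0 R, edist (0 : EuclideanSpace ℝ (Fin n)) y ^ (-((n : ℝ) - s)) := by
    rw [← lintegral_indicator measurableSet_ball, ← lintegral_indicator measurableSet_ball,
      ← lintegral_add_left_eq_self _ x]
    congr 1 with y
    simp only [indicator, mem_ball, dist_eq_norm, add_sub_cancel_left, sub_zero]
    split_ifs
    · rw [edist_eq_enorm_sub, edist_eq_enorm_sub]
      congr 1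
      rw [enorm_eq_iff_norm_eq]
      simp
    · rfl
  -- The integrands can differ only at the origin, where a negative power is `⊤` in `ℝ≥0∞` but `0`
  -- in `ℝ`.
  have hae : ∫⁻ y in ball 0 R, edist (0 : EuclideanSpace ℝ (Fin n)) y ^ (-((n : ℝ) - s)) =
      ∫⁻ y in ball 0 R, ENNReal.ofReal (φ y) := by
    refine lintegral_congr_ae (ae_restrict_of_ae ?_)
    have : ∀ᵐ y : EuclideanSpace ℝ (Fin n), y ≠ 0 := by
      simp [ae_iff]
    filter_upwards [this] with y hy
    have : 0 < ‖y‖ := by simpa using hy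
    simp only [φ]
    rw [edist_comm, edist_zero_right, ← ofReal_norm, ENNReal.ofReal_rpow_of_pos this]
  rw [htrans, hae, ← ofReal_integral_eq_lintegral_ofReal (hint R)
    (Eventually.of_forall hφ0), h1]
  refine ENNReal.ofReal_le_ofReal ?_
  have : 0 ≤ R ^ s := by positivity
  nlinarith

/-! ### Layer cake, averages and medians -/

/-- For monotone (coarea) decompositions: `|a - b|` is the measure of the levels separating
`a` and `b`. -/
lemma lintegral_enorm_indicator_Ioi_sub (a b : ℝ) :
    ∫⁻ t : ℝ, ‖(if t < a then (1 : ℝ) else 0) - (if t < b then (1 : ℝ) else 0)‖ₑ = ‖a - b‖ₑ := by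
  wlog h : b ≤ a generalizing a b
  · rw [← enorm_neg (a - b), neg_sub, ← this b a (le_of_not_ge h)]
    congr 1 with t
    rw [← enorm_neg, neg_sub]
  have : ∀ t : ℝ, ‖(if t < a then (1 : ℝ) else 0) - (if t < b then (1 : ℝ) else 0)‖ₑ =
      (Ico b a).indicator 1 t := by
    intro t
    by_cases h1 : t < a <;> by_cases h2 : t < b <;> simp [indicator, h1, h2]
    linarith
  simp_rw [this]
  rw [lintegral_indicator_one measurableSet_Ico, Real.volume_Ico, ← ofReal_norm,
    Real.norm_of_nonneg (by linarith)]

/-- Minkowski's inequality for the layer-cake decomposition of a function. -/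
lemma lintegral_rpow_le_lintegral_meas_rpow {α : Type*} [MeasurableSpace α] (ν : Measure α)
    [IsFiniteMeasure ν] {q : ℝ} (hq : 1 ≤ q) {G : α → ℝ} (hG : Measurable G) :
    (∫⁻ x, ENNReal.ofReal (G x) ^ q ∂ν) ^ (1 / q) ≤ ∫⁻ t in Ioi (0 : ℝ), ν {x | t < G x} ^ (1 / q) := by
  have hq0 : 0 < q := by linarith
  set I := ∫⁻ t in Ioi (0 : ℝ), ν {x | t < G x} ^ (1 / q) with hI
  -- Truncation at height `N` makes `J` finite, so that `J ^ (1 - 1 / q)` can be cancelled from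
  -- `hJ1`; monotone convergence then removes it.
  have key (N : ℕ) : ∫⁻ x, ENNReal.ofReal (min (G x) N) ^ q ∂ν ≤ I ^ q := by
    set H : α → ℝ≥0∞ := fun x => ENNReal.ofReal (min (G x) N) with hH
    have hHm : Measurable H := by fun_prop
    set J := ∫⁻ x, H x ^ q ∂ν with hJ
    have hJtop : J ≠ ⊤ := by
      have : J ≤ ∫⁻ _, (N : ℝ≥0∞) ^ q ∂ν := by
        refine lintegral_mono fun x => ?_
        refine ENNReal.rpow_le_rpow ?_ hq0.le
        rw [← ENNReal.ofReal_natCast]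
        exact ENNReal.ofReal_le_ofReal (min_le_right _ _)
      refine ne_top_of_le_ne_top ?_ this
      rw [lintegral_const]
      exact ENNReal.mul_ne_top (by finiteness) (measure_ne_top _ _)
    have hlayer : ∀ x, H x = ∫⁻ t in Ioi (0 : ℝ), {x | t < min (G x) N}.indicator 1 x := by
      intro x
      have : ∀ t : ℝ, {x | t < min (G x) (N : ℝ)}.indicator (1 : α → ℝ≥0∞) x =
          (Iio (min (G x) (N : ℝ))).indicator 1 t := by
        intro t
        by_cases h : t < min (G x) (N : ℝ)
        · rw [indicator_of_mem (by exact h), indicator_of_mem (by exact h)]; rfl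
        · rw [indicator_of_notMem (by exact h), indicator_of_notMem (by exact h)]
      simp_rw [this]
      rw [lintegral_indicator_one measurableSet_Iio, Measure.restrict_apply measurableSet_Iio,
        inter_comm, Ioi_inter_Iio, Real.volume_Ioo, sub_zero]
    -- Write `H^q` as the integral over `t` of `H^(q-1) 1_{t < H}`, exchange the integrals and apply
    -- Hölder for each `t`.
    have hJ1 : J ≤ J ^ (1 - 1 / q) * I := by
      have e1 : J = ∫⁻ x, (∫⁻ t in Ioi (0 : ℝ),
          H x ^ (q - 1) * {x | t < min (G x) N}.indicator 1 x) ∂ν := by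
        refine lintegral_congr fun x => ?_
        rw [lintegral_const_mul', ← hlayer]
        · nth_rewrite 3 [← ENNReal.rpow_one (H x)]
          rw [← ENNReal.rpow_add_of_nonneg _ _ (by linarith) zero_le_one]
          simp
        · exact ENNReal.rpow_ne_top_of_nonneg (by linarith) ENNReal.ofReal_ne_top
      have hmeas : MeasurableSet {z : α × ℝ | z.2 < min (G z.1) N} :=
        measurableSet_lt (by fun_prop) (by fun_prop)
      rw [lintegral_lintegral_swap] at e1
      · refine e1.le.trans ?_
        rw [hI, ← lintegral_const_mul' _ _ (by
          exact ENNReal.rpow_ne_top_of_nonneg (by rw [sub_nonneg, div_le_one hq0]; exact hq) hJtop)]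
        refine lintegral_mono fun t => ?_
        have hAt : MeasurableSet {x | t < min (G x) (N : ℝ)} :=
          measurableSet_lt (by fun_prop) (by fun_prop)
        have hsub : ν {x | t < min (G x) (N : ℝ)} ≤ ν {x | t < G x} :=
          measure_mono fun x (hx : t < min (G x) (N : ℝ)) => hx.trans_le (min_le_left _ _)
        rcases hq.eq_or_lt with rfl | hq'
        · simp only [sub_self, ENNReal.rpow_zero, one_mul, div_one, ENNReal.rpow_one]
          rw [lintegral_indicator_one hAt]
          exact hsub
        · have hpq : (Real.conjExponent q).HolderConjugate q :=
            (Real.HolderConjugate.conjExponent hq').symm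
          refine (ENNReal.lintegral_mul_le_Lp_mul_Lq ν hpq (by fun_prop)
            ((measurable_one.indicator hAt).aemeasurable)).trans ?_
          have e2 : ∀ x, (H x ^ (q - 1)) ^ Real.conjExponent q = H x ^ q := by
            intro x
            rw [← ENNReal.rpow_mul, Real.conjExponent]
            congr 1
            field_simp [(by linarith : q - 1 ≠ 0)]
          have e3 : 1 / Real.conjExponent q = 1 - 1 / q := by
            rw [Real.conjExponent]
            field_simp
          have e4 : ∀ x, ({x | t < min (G x) (N : ℝ)}.indicator (1 : α → ℝ≥0∞) x) ^ q =
              {x | t < min (G x) (N : ℝ)}.indicator (1 : α → ℝ≥0∞) x := by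
            intro x
            by_cases h : x ∈ {x | t < min (G x) (N : ℝ)}
            · rw [indicator_of_mem h]; simp
            · rw [indicator_of_notMem h]; simp [hq0]
          simp_rw [e2, e4, e3, lintegral_indicator_one hAt]
          gcongr
      · refine AEMeasurable.mul (by fun_prop) ?_
        exact (measurable_one.indicator hmeas).aemeasurable
    rcases eq_or_ne J 0 with h0 | h0
    · rw [h0]; exact zero_le
    have hmul : J ^ (1 / q) ≤ I := by
      have hfin : J ^ (1 - 1 / q) ≠ ⊤ :=
        ENNReal.rpow_ne_top_of_nonneg (by rw [sub_nonneg, div_le_one hq0]; exact hq) hJtop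
      have hpos : J ^ (1 - 1 / q) ≠ 0 := (ENNReal.rpow_pos (pos_iff_ne_zero.2 h0) hJtop).ne'
      rw [← ENNReal.mul_le_mul_iff_right hpos hfin, ← ENNReal.rpow_add _ _ h0 hJtop]
      simpa using hJ1
    calc J = (J ^ (1 / q)) ^ q := by rw [← ENNReal.rpow_mul]; simp [hq0.ne']
      _ ≤ I ^ q := ENNReal.rpow_le_rpow hmul hq0.le
  have hlim : ∫⁻ x, ENNReal.ofReal (G x) ^ q ∂ν ≤ I ^ q := by
    have h1 : ∀ x, ENNReal.ofReal (G x) ^ q = ⨆ N : ℕ, ENNReal.ofReal (min (G x) N) ^ q := by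
      intro x
      refine le_antisymm ?_ (iSup_le fun N => ?_)
      · obtain ⟨N, hN⟩ := exists_nat_ge (G x)
        refine le_iSup_of_le N ?_
        rw [min_eq_left hN]
      · exact ENNReal.rpow_le_rpow (ENNReal.ofReal_le_ofReal (min_le_left _ _)) hq0.le
    simp_rw [h1]
    rw [lintegral_iSup (fun N => by fun_prop)]
    · exact iSup_le key
    · intro N M hNM x
      refine ENNReal.rpow_le_rpow (ENNReal.ofReal_le_ofReal ?_) hq0.le
      exact min_le_min_left _ (by exact_mod_cast hNM)
  calc (∫⁻ x, ENNReal.ofReal (G x) ^ q ∂ν) ^ (1 / q) ≤ (I ^ q) ^ (1 / q) :=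
        ENNReal.rpow_le_rpow hlim (by positivity)
    _ = I := by rw [← ENNReal.rpow_mul]; simp [hq0.ne']

lemma enorm_integral_sub_integral_le {α : Type*} [MeasurableSpace α] (μ ν : Measure α)
    [IsProbabilityMeasure μ] [IsProbabilityMeasure ν] {u : α → ℝ} (hμ : Integrable u μ)
    (hν : Integrable u ν) :
    ‖∫ x, u x ∂μ - ∫ z, u z ∂ν‖ₑ ≤ ∫⁻ x, ∫⁻ z, ‖u z - u x‖ₑ ∂ν ∂μ := by
  have h1 : ∫ x, u x ∂μ - ∫ z, u z ∂ν = ∫ x, (u x - ∫ z, u z ∂ν) ∂μ := by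
    rw [integral_sub hμ (integrable_const _)]
    simp
  rw [h1]
  refine (enorm_integral_le_lintegral_enorm _).trans (lintegral_mono fun x => ?_)
  have h2 : u x - ∫ z, u z ∂ν = ∫ z, (u x - u z) ∂ν := by
    rw [integral_sub (integrable_const _) hν]
    simp
  rw [h2]
  refine (enorm_integral_le_lintegral_enorm _).trans (lintegral_mono fun z => ?_)
  rw [← enorm_neg, neg_sub]

/-- The median is the least `c` whose strict superlevel set has at most half the mass; both bounds
pass to this infimum by continuity of the measure along increasing unions. -/
lemma exists_median {α : Type*} [MeasurableSpace α] (μ : Measure α) [IsFiniteMeasure μ]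
    (hμ : μ ≠ 0) {F : α → ℝ} (hF : Measurable F) {m : ℝ} (hm : ∀ᵐ x ∂μ, |F x| ≤ m) :
    ∃ c : ℝ, μ {x | c < F x} ≤ μ univ / 2 ∧ μ {x | F x < c} ≤ μ univ / 2 := by
  set S : Set ℝ := {c | μ {x | c < F x} ≤ μ univ / 2} with hS
  have huniv : μ univ ≠ 0 := by simpa using hμ
  have hhalf : μ univ / 2 < μ univ := ENNReal.half_lt_self huniv (measure_ne_top _ _)
  have hne : S.Nonempty := by
    refine ⟨m, ?_⟩
    have : μ {x | m < F x} = 0 := by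
      rw [measure_eq_zero_iff_ae_notMem]
      filter_upwards [hm] with x hx
      simpa using (abs_le.1 hx).2
    simp [hS, this]
  have hbdd : BddBelow S := by
    refine ⟨-m - 1, fun c hc => ?_⟩
    by_contra! hlt
    have h1 : μ {x | c < F x} = μ univ := by
      refine measure_congr ?_
      filter_upwards [hm] with x hx
      refine propext ⟨fun _ => trivial, fun _ => ?_⟩
      have := (abs_le.1 hx).1
      show c < F x
      linarith
    have hc' : μ {x | c < F x} ≤ μ univ / 2 := hc
    rw [h1] at hc'
    exact absurd hc' (not_le.2 hhalf)
  obtain ⟨u, hu_anti, hu_tendsto, hu_mem⟩ := exists_seq_tendsto_sInf hne hbdd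
  refine ⟨sInf S, ?_, ?_⟩
  · have hun : {x | sInf S < F x} = ⋃ k : ℕ, {x | u k < F x} := by
      ext x
      simp only [mem_ofPred_eq, mem_iUnion]
      constructor
      · intro hx
        exact ((hu_tendsto.eventually (gt_mem_nhds hx)).exists)
      · rintro ⟨k, hk⟩
        exact (csInf_le hbdd (hu_mem k)).trans_lt hk
    rw [hun, Monotone.measure_iUnion]
    · exact iSup_le fun k => hu_mem k
    · intro i j hij x hx
      exact (hu_anti hij).trans_lt hx
  · have hun : {x | F x < sInf S} = ⋃ k : ℕ, {x | F x < sInf S - 1 / ((k : ℝ) + 1)} := by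
      ext x
      simp only [mem_ofPred_eq, mem_iUnion]
      constructor
      · intro hx
        obtain ⟨k, hk⟩ := exists_nat_one_div_lt (sub_pos.2 hx)
        exact ⟨k, by linarith⟩
      · rintro ⟨k, hk⟩
        have : 0 < 1 / ((k : ℝ) + 1) := by positivity
        linarith
    rw [hun, Monotone.measure_iUnion]
    · refine iSup_le fun k => ?_
      have hk : 0 < 1 / ((k : ℝ) + 1) := by positivity
      have hnot : sInf S - 1 / ((k : ℝ) + 1) ∉ S := fun h => by
        have := csInf_le hbdd h
        linarith
      have hlt : μ univ / 2 < μ {x | sInf S - 1 / ((k : ℝ) + 1) < F x} := not_le.1 hnot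
      have hmeas : MeasurableSet {x | sInf S - 1 / ((k : ℝ) + 1) < F x} :=
        measurableSet_lt measurable_const hF
      calc μ {x | F x < sInf S - 1 / ((k : ℝ) + 1)}
          ≤ μ {x | sInf S - 1 / ((k : ℝ) + 1) < F x}ᶜ :=
            measure_mono fun x (hx : F x < sInf S - 1 / ((k : ℝ) + 1)) => by
              simpa only [mem_compl_iff, mem_ofPred_eq, not_lt] using hx.le
        _ = μ univ - μ {x | sInf S - 1 / ((k : ℝ) + 1) < F x} :=
            measure_compl hmeas (measure_ne_top _ _)
        _ ≤ μ univ - μ univ / 2 := tsub_le_tsub_left hlt.le _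
        _ = μ univ / 2 := ENNReal.sub_half (measure_ne_top _ _)
    · intro i j hij x hx
      have : 1 / ((j : ℝ) + 1) ≤ 1 / ((i : ℝ) + 1) := by gcongr
      simp only [mem_ofPred_eq] at hx ⊢
      linarith

/-! ### Distance to the boundary -/

section Geometry

variable {n : ℕ} {Ω : Set (EuclideanSpace ℝ (Fin n))}

lemma bdryDist_le_add_dist (x y : EuclideanSpace ℝ (Fin n)) :
    bdryDist Ω x ≤ bdryDist Ω y + dist x y :=
  infDist_le_infDist_add_dist

lemma continuous_bdryDist : Continuous (bdryDist Ω) :=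
  continuous_infDist_pt _

/-- Needed because `infDist` to the empty set is `0` by convention. -/
lemma frontier_nonempty_of_isBounded (hn : 1 ≤ n) (hne : Ω.Nonempty)
    (hb : Bornology.IsBounded Ω) : (frontier Ω).Nonempty := by
  have : Nonempty (Fin n) := ⟨⟨0, hn⟩⟩
  rw [nonempty_iff_ne_empty, Ne, frontier_eq_empty_iff, not_or]
  refine ⟨hne.ne_empty, fun h => ?_⟩
  rw [h] at hb
  exact NormedSpace.unbounded_univ ℝ (EuclideanSpace ℝ (Fin n)) hb

lemma bdryDist_pos (hΩ : IsOpen Ω) (hfr : (frontier Ω).Nonempty) {x : EuclideanSpace ℝ (Fin n)}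
    (hx : x ∈ Ω) : 0 < bdryDist Ω x := by
  refine (isClosed_frontier.notMem_iff_infDist_pos hfr).1 fun h => ?_
  rw [hΩ.frontier_eq] at h
  exact h.2 hx

/-- The distance to the frontier does not distinguish inside from outside. A ball that misses the
frontier is connected, so it cannot meet both `Ω` and the complement of its closure. -/
lemma mem_of_dist_lt_bdryDist (hΩ : IsOpen Ω) {x z : EuclideanSpace ℝ (Fin n)} (hx : x ∈ Ω)
    (hz : dist z x < bdryDist Ω x) : z ∈ Ω := by
  by_contra hzΩ
  have hpre : IsPreconnected (ball x (bdryDist Ω x)) := (convex_ball x _).isPreconnected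
  have hx' : x ∈ ball x (bdryDist Ω x) := mem_ball_self (dist_nonneg.trans_lt hz)
  have hnf : ∀ w ∈ ball x (bdryDist Ω x), w ∈ closure Ω → w ∈ Ω := by
    intro w hw hwc
    by_contra hwΩ
    refine disjoint_left.1 disjoint_ball_infDist hw ?_
    rw [hΩ.frontier_eq]
    exact ⟨hwc, hwΩ⟩
  obtain ⟨w, -, hw1, hw2⟩ := hpre Ω (closure Ω)ᶜ hΩ isClosed_closure.isOpen_compl
    (fun w hw => or_iff_not_imp_right.2 fun h => hnf w hw (not_not.1 h)) ⟨x, hx', hx⟩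
    ⟨z, hz, fun h => hzΩ (hnf z hz h)⟩
  exact hw2 (subset_closure hw1)

lemma exists_bdryDist_le (hfr : (frontier Ω).Nonempty) (hb : Bornology.IsBounded Ω) :
    ∃ D : ℝ, 0 < D ∧ ∀ x ∈ Ω, bdryDist Ω x ≤ D := by
  obtain ⟨w, hw⟩ := hfr
  obtain ⟨r, hr⟩ := hb.subset_closedBall w
  refine ⟨max r 1, by positivity, fun x hx => ?_⟩
  exact (infDist_le_dist_of_mem hw).trans ((hr hx).trans (le_max_left _ _))

end Geometry

/-! ### The fractional kernel and differences of averages -/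

section Kernel

variable {n : ℕ}

/-- The kernel `δ(x,z)^b / |z - x|^(n+s)`. -/
noncomputable def fracKernel (Ω : Set (EuclideanSpace ℝ (Fin n))) (s b : ℝ)
    (x z : EuclideanSpace ℝ (Fin n)) : ℝ≥0∞ :=
  ENNReal.ofReal (minBdryDist Ω x z ^ b / ‖z - x‖ ^ ((n : ℝ) + s))

/-- The inner integral of the fractional seminorm. -/
noncomputable def fracInner (Ω : Set (EuclideanSpace ℝ (Fin n))) (s b : ℝ)
    (f : EuclideanSpace ℝ (Fin n) → ℝ) (x : EuclideanSpace ℝ (Fin n)) : ℝ≥0∞ :=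
  ∫⁻ z in closedBall x (bdryDist Ω x / 2), ‖f z - f x‖ₑ * fracKernel Ω s b x z

variable {Ω : Set (EuclideanSpace ℝ (Fin n))}

lemma fracSeminormOne_eq_lintegral_fracInner (s b : ℝ) (f : EuclideanSpace ℝ (Fin n) → ℝ) :
    fracSeminormOne Ω s b f = ∫⁻ x in Ω, fracInner Ω s b f x := by
  refine lintegral_congr fun x => lintegral_congr fun z => ?_
  rw [fracKernel, ← ofReal_norm, ← ENNReal.ofReal_mul (norm_nonneg _), Real.norm_eq_abs]
  congr 1
  ring

lemma measurable_fracKernel (s b : ℝ) :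
    Measurable fun p : EuclideanSpace ℝ (Fin n) × EuclideanSpace ℝ (Fin n) =>
      fracKernel Ω s b p.1 p.2 := by
  have hd : Measurable (bdryDist Ω) := continuous_bdryDist.measurable
  have hm : Measurable fun p : EuclideanSpace ℝ (Fin n) × EuclideanSpace ℝ (Fin n) =>
      minBdryDist Ω p.1 p.2 := (hd.comp measurable_fst).min (hd.comp measurable_snd)
  unfold fracKernel
  fun_prop

lemma fracInner_eq_lintegral_indicator (s b : ℝ) (f : EuclideanSpace ℝ (Fin n) → ℝ)
    (x : EuclideanSpace ℝ (Fin n)) :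
    fracInner Ω s b f x = ∫⁻ z,
      {p : EuclideanSpace ℝ (Fin n) × EuclideanSpace ℝ (Fin n) |
        dist p.2 p.1 ≤ bdryDist Ω p.1 / 2}.indicator
        (fun p => ‖f p.2 - f p.1‖ₑ * fracKernel Ω s b p.1 p.2) (x, z) := by
  rw [fracInner, ← lintegral_indicator measurableSet_closedBall]
  rfl

lemma measurableSet_dist_le_bdryDist :
    MeasurableSet {p : EuclideanSpace ℝ (Fin n) × EuclideanSpace ℝ (Fin n) |
        dist p.2 p.1 ≤ bdryDist Ω p.1 / 2} := by
  have hd : Measurable (bdryDist Ω) := continuous_bdryDist.measurable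
  exact measurableSet_le (by fun_prop) (by fun_prop)

lemma measurable_fracInner (s b : ℝ) {f : EuclideanSpace ℝ (Fin n) → ℝ} (hf : Measurable f) :
    Measurable (fracInner Ω s b f) := by
  simp_rw [funext (fracInner_eq_lintegral_indicator s b f)]
  refine Measurable.lintegral_prod_right' (f := indicator _ _) ?_
  refine Measurable.indicator ?_ measurableSet_dist_le_bdryDist
  have := measurable_fracKernel (Ω := Ω) s b
  fun_prop

lemma rpow_le_mul_minBdryDist_rpow (b : ℝ) {x z : EuclideanSpace ℝ (Fin n)}
    (hx : 0 < bdryDist Ω x) (hz : dist z x ≤ bdryDist Ω x / 2) :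
    bdryDist Ω x ^ b ≤ 2 ^ |b| * minBdryDist Ω x z ^ b := by
  have h1 : bdryDist Ω x ≤ bdryDist Ω z + dist x z := bdryDist_le_add_dist x z
  rw [dist_comm] at h1
  have h2 : bdryDist Ω x / 2 ≤ minBdryDist Ω x z := le_min (by linarith) (by linarith)
  have h3 : minBdryDist Ω x z ≤ bdryDist Ω x := min_le_left _ _
  have h4 : 0 < minBdryDist Ω x z := by linarith
  rcases le_total 0 b with hb | hb
  · rw [abs_of_nonneg hb, ← Real.mul_rpow (by norm_num) h4.le]
    exact Real.rpow_le_rpow hx.le (by linarith) hb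
  · calc bdryDist Ω x ^ b ≤ minBdryDist Ω x z ^ b := Real.rpow_le_rpow_of_nonpos h4 h3 hb
      _ ≤ 2 ^ |b| * minBdryDist Ω x z ^ b :=
        le_mul_of_one_le_left (by positivity) (Real.one_le_rpow (by norm_num) (abs_nonneg b))

/-- Since `d(x)/2 ≤ δ(x,z) ≤ d(x)` here, the kernel times `d(x)^(-b)` is bounded below by a multiple
of `L^(-(n+s))`. -/
lemma enorm_sub_le_fracKernel {s b L : ℝ} (hns : 0 ≤ (n : ℝ) + s) (u : EuclideanSpace ℝ (Fin n) → ℝ)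
    {x z : EuclideanSpace ℝ (Fin n)} (hx : 0 < bdryDist Ω x) (hz : dist z x ≤ bdryDist Ω x / 2)
    (hL : dist z x ≤ L) :
    ‖u z - u x‖ₑ ≤ ENNReal.ofReal (2 ^ |b| * L ^ ((n : ℝ) + s)) *
      (ENNReal.ofReal (bdryDist Ω x ^ (-b)) * (‖u z - u x‖ₑ * fracKernel Ω s b x z)) := by
  rcases eq_or_ne z x with rfl | hne
  · simp
  have hpos : 0 < ‖z - x‖ := by rwa [norm_pos_iff, sub_ne_zero]
  have hL' : ‖z - x‖ ≤ L := by rwa [← dist_eq_norm]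
  have hL0 : 0 < L := hpos.trans_le hL'
  have key : 1 ≤ (2 ^ |b| * L ^ ((n : ℝ) + s)) * (bdryDist Ω x ^ (-b) *
      (minBdryDist Ω x z ^ b / ‖z - x‖ ^ ((n : ℝ) + s))) := by
    have h1 := rpow_le_mul_minBdryDist_rpow b hx hz
    have h2 : ‖z - x‖ ^ ((n : ℝ) + s) ≤ L ^ ((n : ℝ) + s) :=
      Real.rpow_le_rpow hpos.le hL' hns
    have h3 : 0 < bdryDist Ω x ^ b := by positivity
    have h4 : 0 < ‖z - x‖ ^ ((n : ℝ) + s) := by positivity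
    rw [Real.rpow_neg hx.le]
    calc (1 : ℝ) = (bdryDist Ω x ^ b / bdryDist Ω x ^ b) *
          (‖z - x‖ ^ ((n : ℝ) + s) / ‖z - x‖ ^ ((n : ℝ) + s)) := by
          rw [div_self h3.ne', div_self h4.ne', one_mul]
      _ ≤ ((2 ^ |b| * minBdryDist Ω x z ^ b) / bdryDist Ω x ^ b) *
          (L ^ ((n : ℝ) + s) / ‖z - x‖ ^ ((n : ℝ) + s)) := by
          gcongr
          exact div_nonneg (h3.le.trans h1) h3.le
      _ = _ := by ring
  calc ‖u z - u x‖ₑ = ‖u z - u x‖ₑ * 1 := (mul_one _).symm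
    _ ≤ ‖u z - u x‖ₑ * ENNReal.ofReal ((2 ^ |b| * L ^ ((n : ℝ) + s)) * (bdryDist Ω x ^ (-b) *
      (minBdryDist Ω x z ^ b / ‖z - x‖ ^ ((n : ℝ) + s)))) := by
        gcongr
        rwa [ENNReal.one_le_ofReal]
    _ = _ := by
        rw [ENNReal.ofReal_mul (p := 2 ^ |b| * L ^ ((n : ℝ) + s)) (by positivity),
          ENNReal.ofReal_mul (p := bdryDist Ω x ^ (-b)) (by positivity), fracKernel]
        ring

lemma volume_closedBall_eq (x : EuclideanSpace ℝ (Fin n)) {r : ℝ} (hr : 0 ≤ r) :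
    volume (closedBall x r) =
      ENNReal.ofReal (r ^ n * volume.real (ball (0 : EuclideanSpace ℝ (Fin n)) 1)) := by
  rw [Measure.addHaar_closedBall _ _ hr, ENNReal.ofReal_mul (by positivity), Measure.real,
    ENNReal.ofReal_toReal measure_ball_lt_top.ne]
  simp

lemma volume_real_unitBall_pos : 0 < volume.real (ball (0 : EuclideanSpace ℝ (Fin n)) 1) :=
  ENNReal.toReal_pos (measure_ball_pos _ _ one_pos).ne' measure_ball_lt_top.ne

/-- One link of the chain. The two volumes contribute `t^(-2n)` and the kernel bound `t^(n+s)`,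
whence `t^(s-n)`. -/
lemma exists_enorm_average_sub_average_le {s b ρ θ Λ : ℝ} (hns : 0 ≤ (n : ℝ) + s)
    (hρ : 0 < ρ) (hθ : 0 < θ) (hΛ : 0 < Λ) :
    ∃ C : ℝ, 0 < C ∧ ∀ (u : EuclideanSpace ℝ (Fin n) → ℝ), LocallyIntegrable u →
      ∀ (x₁ x₂ : EuclideanSpace ℝ (Fin n)) (t : ℝ), 0 < t →
      (∀ x ∈ closedBall x₁ (ρ * t), ∀ z ∈ closedBall x₂ (ρ * (θ * t)),
        0 < bdryDist Ω x ∧ dist z x ≤ bdryDist Ω x / 2 ∧ dist z x ≤ Λ * t) →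
      ‖(⨍ x in closedBall x₁ (ρ * t), u x) - ⨍ z in closedBall x₂ (ρ * (θ * t)), u z‖ₑ ≤
        ENNReal.ofReal (C * t ^ (-((n : ℝ) - s))) * ∫⁻ x in closedBall x₁ (ρ * t),
          ENNReal.ofReal (bdryDist Ω x ^ (-b)) * fracInner Ω s b u x := by
  set v := volume.real (ball (0 : EuclideanSpace ℝ (Fin n)) 1) with hv
  have hv0 : 0 < v := volume_real_unitBall_pos
  refine ⟨(ρ ^ n * v)⁻¹ * ((ρ * θ) ^ n * v)⁻¹ * (2 ^ |b| * Λ ^ ((n : ℝ) + s)), by positivity,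
    fun u hu x₁ x₂ t ht hB => ?_⟩
  set B₁ := closedBall x₁ (ρ * t) with hB₁
  set B₂ := closedBall x₂ (ρ * (θ * t)) with hB₂
  have hvol₁ : volume B₁ = ENNReal.ofReal ((ρ * t) ^ n * v) :=
    volume_closedBall_eq _ (by positivity)
  have hvol₂ : volume B₂ = ENNReal.ofReal ((ρ * (θ * t)) ^ n * v) :=
    volume_closedBall_eq _ (by positivity)
  have h10 : volume B₁ ≠ 0 := by
    rw [hvol₁]; exact (ENNReal.ofReal_pos.2 (by positivity)).ne'
  have h20 : volume B₂ ≠ 0 := by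
    rw [hvol₂]; exact (ENNReal.ofReal_pos.2 (by positivity)).ne'
  have h1t : volume B₁ ≠ ⊤ := by rw [hvol₁]; exact ENNReal.ofReal_ne_top
  have h2t : volume B₂ ≠ ⊤ := by rw [hvol₂]; exact ENNReal.ofReal_ne_top
  have p1 : IsProbabilityMeasure ((volume B₁)⁻¹ • volume.restrict B₁) :=
    ProbabilityTheory.cond_isProbabilityMeasure_of_finite h10 h1t
  have p2 : IsProbabilityMeasure ((volume B₂)⁻¹ • volume.restrict B₂) :=
    ProbabilityTheory.cond_isProbabilityMeasure_of_finite h20 h2t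
  have i1 : Integrable u ((volume B₁)⁻¹ • volume.restrict B₁) :=
    (integrable_inv_smul_measure h10 h1t).2 (hu.integrableOn_isCompact (isCompact_closedBall _ _))
  have i2 : Integrable u ((volume B₂)⁻¹ • volume.restrict B₂) :=
    (integrable_inv_smul_measure h20 h2t).2 (hu.integrableOn_isCompact (isCompact_closedBall _ _))
  rw [setAverage_eq', setAverage_eq']
  refine (enorm_integral_sub_integral_le _ _ i1 i2).trans ?_
  rw [lintegral_smul_measure]
  simp_rw [lintegral_smul_measure, smul_eq_mul]
  have hL : 0 < Λ * t := by positivity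
  set c₂ := ENNReal.ofReal (2 ^ |b| * (Λ * t) ^ ((n : ℝ) + s)) with hc₂
  have inner : ∀ x ∈ B₁, ∫⁻ z in B₂, ‖u z - u x‖ₑ ≤
      c₂ * (ENNReal.ofReal (bdryDist Ω x ^ (-b)) * fracInner Ω s b u x) := by
    intro x hx
    calc ∫⁻ z in B₂, ‖u z - u x‖ₑ
        ≤ ∫⁻ z in B₂, c₂ * (ENNReal.ofReal (bdryDist Ω x ^ (-b)) *
            (‖u z - u x‖ₑ * fracKernel Ω s b x z)) :=
          setLIntegral_mono' measurableSet_closedBall fun z hz =>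
            enorm_sub_le_fracKernel hns u (hB x hx z hz).1 (hB x hx z hz).2.1 (hB x hx z hz).2.2
      _ = c₂ * (ENNReal.ofReal (bdryDist Ω x ^ (-b)) *
            ∫⁻ z in B₂, ‖u z - u x‖ₑ * fracKernel Ω s b x z) := by
          rw [lintegral_const_mul' _ _ ENNReal.ofReal_ne_top,
            lintegral_const_mul' _ _ ENNReal.ofReal_ne_top]
      _ ≤ _ := by
          gcongr
          refine lintegral_mono_set fun z hz => (hB x hx z hz).2.1
  calc (volume B₁)⁻¹ * ∫⁻ x in B₁, (volume B₂)⁻¹ * ∫⁻ z in B₂, ‖u z - u x‖ₑ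
      ≤ (volume B₁)⁻¹ * ∫⁻ x in B₁, (volume B₂)⁻¹ *
          (c₂ * (ENNReal.ofReal (bdryDist Ω x ^ (-b)) * fracInner Ω s b u x)) := by
        gcongr 1
        refine setLIntegral_mono' measurableSet_closedBall fun x hx => ?_
        gcongr
        exact inner x hx
    _ = ((volume B₁)⁻¹ * ((volume B₂)⁻¹ * c₂)) *
          ∫⁻ x in B₁, ENNReal.ofReal (bdryDist Ω x ^ (-b)) * fracInner Ω s b u x := by
        rw [lintegral_const_mul' _ _ (ENNReal.inv_ne_top.2 h20),
          lintegral_const_mul' _ _ ENNReal.ofReal_ne_top]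
        ring
    _ = _ := by
        congr 1
        rw [hvol₁, hvol₂, hc₂, ← ENNReal.ofReal_inv_of_pos (by positivity),
          ← ENNReal.ofReal_inv_of_pos (by positivity), ← ENNReal.ofReal_mul (by positivity),
          ← ENNReal.ofReal_mul (by positivity)]
        congr 1
        have : t ^ (-((n : ℝ) - s)) = t ^ ((n : ℝ) + s) * (t ^ n)⁻¹ * (t ^ n)⁻¹ := by
          rw [← Real.rpow_natCast, ← Real.rpow_neg ht.le, ← Real.rpow_add ht, ← Real.rpow_add ht]
          congr 1
          ring
        rw [this, Real.mul_rpow hΛ.le ht.le, mul_pow, mul_pow, mul_pow, mul_pow]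
        simp only [mul_inv]
        ring

end Kernel

/-! ### Chains of balls along John curves -/

section Chain

variable {n : ℕ} {Ω : Set (EuclideanSpace ℝ (Fin n))}

/-- The Riesz kernel `|x - y|^(s-n)`, restricted to the points `x` with `|x - y| ≤ M d(x)`. -/
noncomputable def rieszKernel (Ω : Set (EuclideanSpace ℝ (Fin n))) (s M : ℝ)
    (x y : EuclideanSpace ℝ (Fin n)) : ℝ≥0∞ :=
  {x | dist x y ≤ M * bdryDist Ω x}.indicator (fun x => edist x y ^ (-((n : ℝ) - s))) x

lemma measurable_rieszKernel (s M : ℝ) :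
    Measurable fun p : EuclideanSpace ℝ (Fin n) × EuclideanSpace ℝ (Fin n) =>
      rieszKernel Ω s M p.1 p.2 := by
  have hd : Measurable (bdryDist Ω) := continuous_bdryDist.measurable
  have hset : MeasurableSet {p : EuclideanSpace ℝ (Fin n) × EuclideanSpace ℝ (Fin n) |
      dist p.1 p.2 ≤ M * bdryDist Ω p.1} := measurableSet_le (by fun_prop) (by fun_prop)
  exact Measurable.indicator (f := fun p : EuclideanSpace ℝ (Fin n) × EuclideanSpace ℝ (Fin n) =>
    edist p.1 p.2 ^ (-((n : ℝ) - s))) (by fun_prop) hset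

theorem IsJohnDomain.exists_enorm_sub_average_le (hΩ : IsJohnDomain Ω) (hn : 1 ≤ n) {s : ℝ}
    (hs : 0 ≤ s) (hsn : s < n) (b : ℝ) :
    ∃ x₀ : EuclideanSpace ℝ (Fin n), ∃ ρ : ℝ, 0 < ρ ∧ closedBall x₀ ρ ⊆ Ω ∧
      ∃ C : ℝ, 0 < C ∧ ∃ M : ℝ, 0 < M ∧
        ∀ u : EuclideanSpace ℝ (Fin n) → ℝ, Measurable u → LocallyIntegrable u →
          ∀ᵐ y, y ∈ Ω → ‖u y - ⨍ x in closedBall x₀ ρ, u x‖ₑ ≤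
            ENNReal.ofReal C * ∫⁻ x in Ω, rieszKernel Ω s M x y *
              (ENNReal.ofReal (bdryDist Ω x ^ (-b)) * fracInner Ω s b u x) := by
  obtain ⟨hopen, hconn, hbdd, x₀, hx₀, γ, lam, hlam, K, hK, -, -, hend, hmem, hlip, -⟩ := hΩ
  have hfr := frontier_nonempty_of_isBounded hn hconn.nonempty hbdd
  have hK' : (0 : ℝ) < K := hK
  -- With `ρ = lam / 8`, points of the ball of radius `ρ t` have `d ≥ 7 ρ t`. The choice of `θ` puts
  -- consecutive centres within `ρ t`, so points of consecutive balls are within `3 ρ t ≤ d / 2`, as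
  -- the seminorm requires.
  set ρ : ℝ := lam / 8 with hρdef
  have hρ : 0 < ρ := by positivity
  set θ : ℝ := 1 - ρ / (K + lam) with hθdef
  have hθsub : ρ / (K + lam) < 1 := by
    rw [div_lt_one (by positivity)]
    linarith
  have hθ : 0 < θ := by linarith
  have hθ1 : θ < 1 := by
    have : 0 < ρ / (K + lam) := by positivity
    linarith
  have hKθ : K * (1 - θ) ≤ ρ := by
    rw [hθdef, sub_sub_cancel, mul_div_assoc', div_le_iff₀ (by positivity)]
    nlinarith
  have hmem' : ∀ y ∈ Ω, ∀ t ∈ Icc (0 : ℝ) 1, γ y t ∈ Ω ∧ 8 * ρ * t ≤ bdryDist Ω (γ y t) := by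
    intro y hy t ht
    have := hmem y hy t ht
    rw [Real.rpow_one] at this
    refine ⟨this.1, ?_⟩
    have h8 : 8 * ρ = lam := by rw [hρdef]; ring
    rw [h8]
    exact this.2
  have hdist : ∀ y ∈ Ω, ∀ t ∈ Icc (0 : ℝ) 1, ∀ t' ∈ Icc (0 : ℝ) 1,
      dist (γ y t) (γ y t') ≤ K * |t - t'| := by
    intro y hy t ht t' ht'
    have := (hlip y hy).dist_le_mul t ht t' ht'
    rwa [Real.dist_eq] at this
  -- points of the ball of radius `ρ t` about `γ y t`
  have hpt : ∀ y ∈ Ω, ∀ t ∈ Icc (0 : ℝ) 1, 0 < t → ∀ x ∈ closedBall (γ y t) (ρ * t),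
      x ∈ Ω ∧ 7 * ρ * t ≤ bdryDist Ω x ∧ dist x y ≤ (K + ρ) * t := by
    intro y hy t ht ht0 x hx
    rw [mem_closedBall] at hx
    have h1 := hmem' y hy t ht
    have h2 := bdryDist_le_add_dist (Ω := Ω) (γ y t) x
    rw [dist_comm] at h2
    have h3 := hdist y hy t ht 0 (by simp)
    rw [(hend y hy).1, sub_zero, abs_of_pos ht0] at h3
    have hρt : 0 < ρ * t := by positivity
    refine ⟨mem_of_dist_lt_bdryDist hopen h1.1 (by linarith [h1.2]), by linarith [h1.2], ?_⟩
    have := dist_triangle x (γ y t) y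
    linarith
  have htk (k : ℕ) : 0 < θ ^ k := by positivity
  have htk1 (k : ℕ) : θ ^ k ∈ Icc (0 : ℝ) 1 := ⟨(htk k).le, pow_le_one₀ hθ.le hθ1.le⟩
  have hns : 0 ≤ (n : ℝ) + s := by positivity
  obtain ⟨C₁, hC₁, hstep⟩ := exists_enorm_average_sub_average_le (n := n) (Ω := Ω) (s := s) (b := b)
    (Λ := 3 * ρ) hns hρ hθ (by positivity)
  obtain ⟨C₂, hC₂, hgeom⟩ := tsum_geometric_kernel_le (p := (n : ℝ) - s) (M := K + ρ) hθ hθ1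
    (by linarith) (by positivity)
  refine ⟨x₀, ρ, hρ, ?_, C₁ * C₂, by positivity, (K + ρ) / ρ, by positivity, fun u hum hu => ?_⟩
  · intro x hx
    have h := hpt x₀ hx₀ 1 (by simp) one_pos x
    rw [(hend x₀ hx₀).2, mul_one] at h
    exact (h hx).1
  -- The balls are not centred at `y`, but their centres lie within `K θ^k = (K / ρ) · ρ θ^k` of it,
  -- so the Lebesgue differentiation theorem for such off-centre balls applies.
  filter_upwards [IsUnifLocDoublingMeasure.ae_tendsto_average volume hu (K / ρ)] with y hleb hy
  have hlim : Tendsto (fun k : ℕ => ⨍ x in closedBall (γ y (θ ^ k)) (ρ * θ ^ k), u x) atTop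
      (𝓝 (u y)) := by
    refine hleb _ _ ?_ (Eventually.of_forall fun k => ?_)
    · refine tendsto_nhdsWithin_iff.2 ⟨?_, Eventually.of_forall fun k => ?_⟩
      · simpa using (tendsto_pow_atTop_nhds_zero_of_lt_one hθ.le hθ1).const_mul ρ
      · exact mul_pos hρ (htk k)
    · have h3 := hdist y hy 0 (by simp) (θ ^ k) (htk1 k)
      rw [(hend y hy).1, zero_sub, abs_neg, abs_of_pos (htk k)] at h3
      rw [mem_closedBall, ← mul_assoc, div_mul_cancel₀ _ hρ.ne']
      exact h3
  set g : EuclideanSpace ℝ (Fin n) → ℝ≥0∞ := fun x =>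
    ENNReal.ofReal (bdryDist Ω x ^ (-b)) * fracInner Ω s b u x with hg
  have hgm : Measurable g := by
    have := measurable_fracInner (Ω := Ω) s b hum
    have hd : Measurable (bdryDist Ω) := continuous_bdryDist.measurable
    fun_prop
  have hchain := edist_le_tsum_of_edist_le_of_tendsto₀
    (fun k : ℕ => ENNReal.ofReal (C₁ * (θ ^ k) ^ (-((n : ℝ) - s))) *
      ∫⁻ x in closedBall (γ y (θ ^ k)) (ρ * θ ^ k), g x) (fun k => ?_) hlim
  · rw [pow_zero, mul_one, (hend y hy).2, edist_comm, edist_eq_enorm_sub] at hchain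
    refine hchain.trans ?_
    have e1 (k : ℕ) : ENNReal.ofReal (C₁ * (θ ^ k) ^ (-((n : ℝ) - s))) *
        ∫⁻ x in closedBall (γ y (θ ^ k)) (ρ * θ ^ k), g x =
        ∫⁻ x, (closedBall (γ y (θ ^ k)) (ρ * θ ^ k)).indicator
          (fun x => ENNReal.ofReal (C₁ * (θ ^ k) ^ (-((n : ℝ) - s))) * g x) x := by
      rw [lintegral_indicator measurableSet_closedBall,
        lintegral_const_mul' _ _ ENNReal.ofReal_ne_top]
    simp_rw [e1]
    rw [← lintegral_tsum fun k => ((hgm.const_mul _).indicator measurableSet_closedBall).aemeasurable,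
      ← lintegral_const_mul' _ _ ENNReal.ofReal_ne_top, ← lintegral_indicator hopen.measurableSet]
    refine lintegral_mono fun x => ?_
    -- Outside this set no ball of the chain contains `x`, so every term vanishes.
    by_cases hx : x ∈ Ω ∧ dist x y ≤ (K + ρ) / ρ * bdryDist Ω x
    · rw [indicator_of_mem hx.1, rieszKernel, indicator_of_mem (by exact hx.2)]
      calc ∑' k : ℕ, (closedBall (γ y (θ ^ k)) (ρ * θ ^ k)).indicator
            (fun x => ENNReal.ofReal (C₁ * (θ ^ k) ^ (-((n : ℝ) - s))) * g x) x
          ≤ ∑' k : ℕ, (if dist x y ≤ (K + ρ) * θ ^ k then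
              ENNReal.ofReal ((θ ^ k) ^ (-((n : ℝ) - s))) else 0) * (ENNReal.ofReal C₁ * g x) := by
            refine ENNReal.tsum_le_tsum fun k => ?_
            by_cases hk : x ∈ closedBall (γ y (θ ^ k)) (ρ * θ ^ k)
            · rw [indicator_of_mem hk, if_pos (hpt y hy _ (htk1 k) (htk k) x hk).2.2,
                ENNReal.ofReal_mul hC₁.le]
              exact le_of_eq (by ring)
            · rw [indicator_of_notMem hk]
              exact zero_le
        _ ≤ (ENNReal.ofReal C₂ * ENNReal.ofReal (dist x y) ^ (-((n : ℝ) - s))) *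
              (ENNReal.ofReal C₁ * g x) := by
            rw [ENNReal.tsum_mul_right]
            gcongr
            exact hgeom _ dist_nonneg
        _ = _ := by
            rw [← edist_dist, ENNReal.ofReal_mul hC₁.le]
            ring
    · refine le_of_eq_of_le ?_ zero_le
      rw [ENNReal.tsum_eq_zero]
      intro k
      refine indicator_of_notMem (fun hk => hx ?_) _
      obtain ⟨h1, h2, h3⟩ := hpt y hy _ (htk1 k) (htk k) x hk
      refine ⟨h1, h3.trans ?_⟩
      have h4 : ρ * θ ^ k ≤ bdryDist Ω x := by
        have := htk k
        nlinarith
      calc (K + ρ) * θ ^ k = (K + ρ) / ρ * (ρ * θ ^ k) := by field_simp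
        _ ≤ _ := by gcongr
  · rw [edist_eq_enorm_sub, pow_succ']
    refine hstep u hu _ _ _ (htk k) fun x hx z hz => ?_
    have hk1 := htk1 (k + 1)
    rw [pow_succ'] at hk1
    have hk0 := htk k
    have h1 := hpt y hy _ (htk1 k) hk0 x hx
    rw [mem_closedBall] at hx hz
    have h2 := hdist y hy (θ * θ ^ k) hk1 (θ ^ k) (htk1 k)
    have h3 : K * |θ * θ ^ k - θ ^ k| ≤ ρ * θ ^ k := by
      rw [abs_sub_comm, show θ ^ k - θ * θ ^ k = (1 - θ) * θ ^ k by ring,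
        abs_of_pos (mul_pos (by linarith) hk0), ← mul_assoc]
      gcongr
    have h4 : ρ * (θ * θ ^ k) ≤ ρ * θ ^ k := by
      gcongr
      exact mul_le_of_le_one_left hk0.le hθ1.le
    have h5 := dist_triangle4 z (γ y (θ * θ ^ k)) (γ y (θ ^ k)) x
    rw [dist_comm (γ y (θ ^ k)) x] at h5
    have h6 : 0 < ρ * θ ^ k := by positivity
    exact ⟨by linarith [h1.2.1], by linarith [h1.2.1], by linarith⟩

end Chain

lemma lintegral_lintegral_mul_swap {α β : Type*} [MeasurableSpace α] [MeasurableSpace β]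
    (μ : Measure α) (ν : Measure β) [SFinite μ] [SFinite ν] {k : α → β → ℝ≥0∞} {g : α → ℝ≥0∞}
    (hk : Measurable fun p : α × β => k p.1 p.2) (hg : Measurable g) :
    ∫⁻ y, (∫⁻ x, k x y * g x ∂μ) ∂ν = ∫⁻ x, (∫⁻ y, k x y ∂ν) * g x ∂μ := by
  have hk' : Measurable fun p : β × α => k p.2 p.1 := hk.comp measurable_swap
  rw [lintegral_lintegral_swap (hk'.mul (hg.comp measurable_snd)).aemeasurable]
  refine lintegral_congr fun x => ?_
  have h : Measurable fun y => k x y := hk.comp measurable_prodMk_left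
  rw [lintegral_mul_const _ h]

/-! ### The weighted isoperimetric inequality -/

section Isoperimetric

variable {n : ℕ} {Ω : Set (EuclideanSpace ℝ (Fin n))}

lemma bdryDist_nonneg (x : EuclideanSpace ℝ (Fin n)) : 0 ≤ bdryDist Ω x := infDist_nonneg

lemma distWeightMeasure_restrict_le {a c : ℝ} (ha : 0 ≤ a) {S : Set (EuclideanSpace ℝ (Fin n))}
    (hS : MeasurableSet S) (hc : ∀ y ∈ S ∩ Ω, bdryDist Ω y ≤ c) (hΩ : MeasurableSet Ω) :
    (distWeightMeasure Ω a).restrict S ≤ ENNReal.ofReal (c ^ a) • volume.restrict S := by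
  refine Measure.le_iff.2 fun T hT => ?_
  rw [Measure.restrict_apply hT, distWeightMeasure, withDensity_apply _ (hT.inter hS),
    Measure.restrict_restrict (hT.inter hS), Measure.smul_apply, smul_eq_mul,
    Measure.restrict_apply hT]
  calc ∫⁻ y in T ∩ S ∩ Ω, ENNReal.ofReal (bdryDist Ω y ^ a)
      ≤ ∫⁻ _ in T ∩ S ∩ Ω, ENNReal.ofReal (c ^ a) := by
        refine setLIntegral_mono' ((hT.inter hS).inter hΩ) fun y hy => ?_
        exact ENNReal.ofReal_le_ofReal
          (Real.rpow_le_rpow (bdryDist_nonneg y) (hc y ⟨hy.1.2, hy.2⟩) ha)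
    _ = ENNReal.ofReal (c ^ a) * volume (T ∩ S ∩ Ω) := setLIntegral_const _ _
    _ ≤ _ := mul_le_mul' le_rfl (measure_mono inter_subset_left)

lemma isFiniteMeasure_distWeightMeasure {a D : ℝ} (ha : 0 ≤ a) (hΩ : MeasurableSet Ω)
    (hb : Bornology.IsBounded Ω) (hD : ∀ x ∈ Ω, bdryDist Ω x ≤ D) :
    IsFiniteMeasure (distWeightMeasure Ω a) := by
  refine ⟨?_⟩
  rw [distWeightMeasure, withDensity_apply _ .univ, Measure.restrict_univ]
  calc ∫⁻ y in Ω, ENNReal.ofReal (bdryDist Ω y ^ a) ≤ ∫⁻ _ in Ω, ENNReal.ofReal (D ^ a) :=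
        setLIntegral_mono' hΩ fun y hy => ENNReal.ofReal_le_ofReal
          (Real.rpow_le_rpow (bdryDist_nonneg y) (hD y hy) ha)
    _ < ⊤ := by
        rw [setLIntegral_const]
        exact ENNReal.mul_lt_top ENNReal.ofReal_lt_top hb.measure_lt_top

/-- After factoring out `(d^a R^n)^(1-1/q)`, the surplus power of `R` has exponent `s - n + n/q`,
nonnegative by `hq₂`, and is traded for a power of `d`. What then exceeds `d^b` has nonnegative
exponent by `hb` and is bounded through `d ≤ D`. -/
lemma rpow_mul_rpow_le_of_le_mul {s q a b C D d R : ℝ} (hs : s < n)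
    (hq₁ : 1 ≤ q) (hq₂ : q ≤ (n : ℝ) / ((n : ℝ) - s)) (hb : b ≤ ((n : ℝ) + a) / q - (n : ℝ) + s)
    (hd : 0 < d) (hdD : d ≤ D) (hR : 0 < R) (hC : 0 < C) (hRd : R ≤ C * d) :
    d ^ a * R ^ s ≤ C ^ (s - n + n / q) * D ^ (((n : ℝ) + a) / q - n + s - b) *
      ((d ^ a * R ^ n) ^ (1 - 1 / q) * d ^ b) := by
  have hq : 0 < q := by linarith
  have he : 0 ≤ s - n + n / q := by
    rw [le_div_iff₀ (by linarith)] at hq₂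
    have : (n : ℝ) - s ≤ n / q := by rw [le_div_iff₀ hq]; linarith
    linarith
  have h1 : R ^ (s - n + n / q) ≤ C ^ (s - n + n / q) * d ^ (s - n + n / q) := by
    rw [← Real.mul_rpow hC.le hd.le]
    exact Real.rpow_le_rpow hR.le hRd he
  have h2 : d ^ (((n : ℝ) + a) / q - n + s - b) ≤ D ^ (((n : ℝ) + a) / q - n + s - b) :=
    Real.rpow_le_rpow hd.le hdD (by linarith)
  have h3 : (d ^ a * R ^ n) ^ (1 - 1 / q) = d ^ (a * (1 - 1 / q)) * R ^ (n * (1 - 1 / q)) := by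
    rw [Real.mul_rpow (by positivity) (by positivity), ← Real.rpow_natCast, ← Real.rpow_mul hd.le,
      ← Real.rpow_mul hR.le]
  have h4 : d ^ a * R ^ s = d ^ (a * (1 - 1 / q)) * R ^ (n * (1 - 1 / q)) *
      (d ^ (a / q) * R ^ (s - n + n / q)) := by
    rw [mul_mul_mul_comm, ← Real.rpow_add hd, ← Real.rpow_add hR]
    congr 2 <;> field_simp <;> ring
  have h5 : d ^ (a / q) * d ^ (s - n + n / q) =
      d ^ b * d ^ (((n : ℝ) + a) / q - n + s - b) := by
    rw [← Real.rpow_add hd, ← Real.rpow_add hd]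
    congr 1
    ring
  rw [h3, h4]
  calc d ^ (a * (1 - 1 / q)) * R ^ (n * (1 - 1 / q)) * (d ^ (a / q) * R ^ (s - n + n / q))
      ≤ d ^ (a * (1 - 1 / q)) * R ^ (n * (1 - 1 / q)) *
        (d ^ (a / q) * (C ^ (s - n + n / q) * d ^ (s - n + n / q))) := by gcongr
    _ = d ^ (a * (1 - 1 / q)) * R ^ (n * (1 - 1 / q)) * C ^ (s - n + n / q) * d ^ b *
          d ^ (((n : ℝ) + a) / q - n + s - b) := by
        rw [show ∀ A B C' E F : ℝ, A * B * (E * (C' * F)) = A * B * C' * (E * F) from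
          fun _ _ _ _ _ => by ring, h5]
        ring
    _ ≤ d ^ (a * (1 - 1 / q)) * R ^ (n * (1 - 1 / q)) * C ^ (s - n + n / q) * d ^ b *
          D ^ (((n : ℝ) + a) / q - n + s - b) := by gcongr
    _ = _ := by ring

/-- On the support of the kernel, `d(y) ≤ (1 + M) d(x)`, so since `a ≥ 0` the weight is at most a
multiple of `d(x)^a`. Splitting at a radius `R` adapted to the mass of `A` bounds both pieces by a
multiple of `d(x)^a R^s`. -/
lemma exists_lintegral_rieszKernel_le (hn : 1 ≤ n) (hopen : IsOpen Ω)
    (hfr : (frontier Ω).Nonempty) (hbdd : Bornology.IsBounded Ω) {s q a b M : ℝ} (hs : 0 < s)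
    (hsn : s < n) (hq₁ : 1 ≤ q) (hq₂ : q ≤ (n : ℝ) / ((n : ℝ) - s)) (ha : 0 ≤ a)
    (hb : b ≤ ((n : ℝ) + a) / q - (n : ℝ) + s) (hM : 0 < M) :
    ∃ C : ℝ, 0 < C ∧ ∀ x ∈ Ω, ∀ A : Set (EuclideanSpace ℝ (Fin n)), MeasurableSet A →
      ∫⁻ y in A, rieszKernel Ω s M x y ∂(distWeightMeasure Ω a) ≤
        ENNReal.ofReal C * (distWeightMeasure Ω a A ^ (1 - 1 / q) *
          ENNReal.ofReal (bdryDist Ω x ^ b)) := by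
  obtain ⟨D, hD, hdD⟩ := exists_bdryDist_le hfr hbdd
  have hfin := isFiniteMeasure_distWeightMeasure ha hopen.measurableSet hbdd hdD
  obtain ⟨C₁, hC₁, hball⟩ := exists_lintegral_ball_edist_rpow hn hs
  set ν := distWeightMeasure Ω a with hν
  set v := volume.real (ball (0 : EuclideanSpace ℝ (Fin n)) 1) with hv
  have hv0 : 0 < v := volume_real_unitBall_pos
  -- Adding `1` gives `C₃ ≥ 1`, so that `C₃ ≤ C₃ ^ n` when an `n`-th root is taken in `hRd`.
  set C₃ : ℝ := (1 + M) ^ a * M ^ n * v + 1 with hC₃def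
  have hc₃ : 0 < (1 + M) ^ a * M ^ n * v := by positivity
  have hC₃ : 0 < C₃ := by positivity
  have hq : 0 < q := by linarith
  have hq' : 0 ≤ 1 - 1 / q := by rw [sub_nonneg, div_le_one hq]; exact hq₁
  refine ⟨((1 + M) ^ a * C₁ + 1) *
    (C₃ ^ (s - n + n / q) * D ^ (((n : ℝ) + a) / q - n + s - b)), by positivity,
    fun x hx A hA => ?_⟩
  set d := bdryDist Ω x with hd
  have hd0 : 0 < d := bdryDist_pos hopen hfr hx
  set A' := A ∩ closedBall x (M * d) with hA'
  have hA'm : MeasurableSet A' := hA.inter measurableSet_closedBall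
  have hdA' : ∀ S ⊆ A', ∀ y ∈ S ∩ Ω, bdryDist Ω y ≤ (1 + M) * d := by
    intro S hS y hy
    have h1 := bdryDist_le_add_dist (Ω := Ω) y x
    have h2 : dist y x ≤ M * d := (hS hy.1).2
    linarith
  have hLHS : ∫⁻ y in A, rieszKernel Ω s M x y ∂ν = ∫⁻ y in A', edist x y ^ (-((n : ℝ) - s)) ∂ν := by
    rw [hA', inter_comm, ← setLIntegral_indicator measurableSet_closedBall]
    refine lintegral_congr fun y => ?_
    simp only [rieszKernel, indicator, mem_closedBall, dist_comm y x]
    rfl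
  have hWtop : ν A' ≠ ⊤ := measure_ne_top _ _
  rw [hLHS]
  rcases eq_or_ne (ν A') 0 with hW0 | hW0
  · rw [Measure.restrict_eq_zero.2 hW0, lintegral_zero_measure]
    exact zero_le
  set w := (ν A').toReal with hw
  have hw0 : 0 < w := ENNReal.toReal_pos hW0 hWtop
  have hWw : ν A' = ENNReal.ofReal w := (ENNReal.ofReal_toReal hWtop).symm
  -- Chosen so that `d^a R^n = ν A'`, which balances the near and far parts.
  set R := (w / d ^ a) ^ (1 / (n : ℝ)) with hRdef
  have hR : 0 < R := by positivity
  have hn0 : (n : ℝ) ≠ 0 := by positivity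
  have hRn : R ^ n = w / d ^ a := by
    rw [hRdef, ← Real.rpow_natCast, ← Real.rpow_mul (by positivity), one_div_mul_cancel hn0,
      Real.rpow_one]
  have hwR : w = d ^ a * R ^ n := by
    rw [hRn]
    field_simp
  have hRd : R ≤ C₃ * d := by
    have h1 : ν A' ≤ ENNReal.ofReal (((1 + M) * d) ^ a) * volume (closedBall x (M * d)) := by
      have := distWeightMeasure_restrict_le ha hA'm (hdA' A' le_rfl) hopen.measurableSet univ
      rw [Measure.restrict_apply_univ, Measure.smul_apply, Measure.restrict_apply_univ,
        smul_eq_mul] at this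
      refine this.trans ?_
      gcongr
      exact inter_subset_right
    rw [volume_closedBall_eq _ (by positivity), ← ENNReal.ofReal_mul (by positivity), hWw,
      ENNReal.ofReal_le_ofReal_iff (by positivity)] at h1
    have h2 : R ^ n ≤ ((1 + M) ^ a * M ^ n * v) * d ^ n := by
      rw [hRn, div_le_iff₀ (by positivity)]
      refine h1.trans_eq ?_
      rw [Real.mul_rpow (by positivity) hd0.le, mul_pow]
      ring
    have h3 : (1 + M) ^ a * M ^ n * v ≤ C₃ ^ n := by
      calc (1 + M) ^ a * M ^ n * v ≤ C₃ := by linarith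
        _ ≤ C₃ ^ n := le_self_pow₀ (by linarith) (by lia)
    refine le_of_pow_le_pow_left₀ (n := n) (by lia) (by positivity) ?_
    rw [mul_pow]
    refine h2.trans ?_
    gcongr
  have hnear : ∫⁻ y in A' ∩ ball x R, edist x y ^ (-((n : ℝ) - s)) ∂ν ≤
      ENNReal.ofReal ((1 + M) ^ a * C₁ * (d ^ a * R ^ s)) := by
    calc ∫⁻ y in A' ∩ ball x R, edist x y ^ (-((n : ℝ) - s)) ∂ν
        ≤ ∫⁻ y, edist x y ^ (-((n : ℝ) - s))
            ∂(ENNReal.ofReal (((1 + M) * d) ^ a) • volume.restrict (A' ∩ ball x R)) :=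
          lintegral_mono' (distWeightMeasure_restrict_le ha (hA'm.inter measurableSet_ball)
            (hdA' _ inter_subset_left) hopen.measurableSet) le_rfl
      _ ≤ ENNReal.ofReal (((1 + M) * d) ^ a) * ∫⁻ y in ball x R, edist x y ^ (-((n : ℝ) - s)) := by
          rw [lintegral_smul_measure, smul_eq_mul]
          gcongr
          exact inter_subset_right
      _ ≤ ENNReal.ofReal (((1 + M) * d) ^ a) * ENNReal.ofReal (C₁ * R ^ s) := by
          gcongr
          exact hball x R hR
      _ = _ := by
          rw [← ENNReal.ofReal_mul (by positivity), Real.mul_rpow (by positivity) hd0.le]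
          congr 1
          ring
  have hfar : ∫⁻ y in A' \ ball x R, edist x y ^ (-((n : ℝ) - s)) ∂ν ≤
      ENNReal.ofReal (d ^ a * R ^ s) := by
    calc ∫⁻ y in A' \ ball x R, edist x y ^ (-((n : ℝ) - s)) ∂ν
        ≤ ∫⁻ _ in A' \ ball x R, ENNReal.ofReal (R ^ (-((n : ℝ) - s))) ∂ν := by
          refine setLIntegral_mono' (hA'm.diff measurableSet_ball) fun y hy => ?_
          have h1 : R ≤ dist x y := by
            rw [dist_comm]
            exact not_lt.1 hy.2
          rw [← ENNReal.ofReal_rpow_of_pos hR, edist_dist]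
          rw [ENNReal.rpow_neg, ENNReal.rpow_neg, ENNReal.inv_le_inv]
          exact ENNReal.rpow_le_rpow (ENNReal.ofReal_le_ofReal h1) (by linarith)
      _ = ENNReal.ofReal (R ^ (-((n : ℝ) - s))) * ν (A' \ ball x R) := setLIntegral_const _ _
      _ ≤ ENNReal.ofReal (R ^ (-((n : ℝ) - s))) * ν A' := by
          gcongr
          exact sdiff_subset
      _ = _ := by
          rw [hWw, ← ENNReal.ofReal_mul (by positivity), hwR]
          congr 1
          have : R ^ s = R ^ (-((n : ℝ) - s)) * R ^ n := by
            rw [← Real.rpow_natCast, ← Real.rpow_add hR]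
            congr 1
            ring
          rw [this]
          ring
  rw [← lintegral_inter_add_sdiff _ A' (measurableSet_ball (x := x) (ε := R))]
  refine (add_le_add hnear hfar).trans ?_
  rw [← ENNReal.ofReal_add (by positivity) (by positivity)]
  calc ENNReal.ofReal ((1 + M) ^ a * C₁ * (d ^ a * R ^ s) + d ^ a * R ^ s)
      = ENNReal.ofReal (((1 + M) ^ a * C₁ + 1) * (d ^ a * R ^ s)) := by
        congr 1
        ring
    _ ≤ ENNReal.ofReal (((1 + M) ^ a * C₁ + 1) *
          (C₃ ^ (s - n + n / q) * D ^ (((n : ℝ) + a) / q - n + s - b) *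
            ((d ^ a * R ^ n) ^ (1 - 1 / q) * d ^ b))) := by
        refine ENNReal.ofReal_le_ofReal ?_
        exact mul_le_mul_of_nonneg_left
          (rpow_mul_rpow_le_of_le_mul hsn hq₁ hq₂ hb hd0 (hdD x hx) hR hC₃ hRd) (by positivity)
    _ = ENNReal.ofReal (((1 + M) ^ a * C₁ + 1) *
          (C₃ ^ (s - n + n / q) * D ^ (((n : ℝ) + a) / q - n + s - b))) *
            (ν A' ^ (1 - 1 / q) * ENNReal.ofReal (d ^ b)) := by
        rw [← hwR, hWw, ENNReal.ofReal_rpow_of_pos hw0, ← ENNReal.ofReal_mul (by positivity),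
          ← ENNReal.ofReal_mul (by positivity)]
        congr 1
        ring
    _ ≤ _ := by
        gcongr
        exact inter_subset_left

theorem IsJohnDomain.exists_measure_rpow_le_fracSeminormOne (hΩ : IsJohnDomain Ω) (hn : 1 ≤ n)
    {s q a b : ℝ} (hs : 0 < s) (hsn : s < n) (hq₁ : 1 ≤ q) (hq₂ : q ≤ (n : ℝ) / ((n : ℝ) - s))
    (ha : 0 ≤ a) (hb : b ≤ ((n : ℝ) + a) / q - (n : ℝ) + s) :
    ∃ x₀ : EuclideanSpace ℝ (Fin n), ∃ ρ : ℝ, 0 < ρ ∧ closedBall x₀ ρ ⊆ Ω ∧ ∃ C : ℝ, 0 < C ∧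
      ∀ A : Set (EuclideanSpace ℝ (Fin n)), MeasurableSet A →
        volume.restrict (closedBall x₀ ρ) A ≤ volume (closedBall x₀ ρ) / 2 →
        distWeightMeasure Ω a A ^ (1 / q) ≤
          ENNReal.ofReal C * fracSeminormOne Ω s b (A.indicator 1) := by
  have hopen := hΩ.isOpen
  have hbdd := hΩ.isBounded
  have hfr := frontier_nonempty_of_isBounded hn hΩ.isConnected.nonempty hbdd
  obtain ⟨x₀, ρ, hρ, hB, C₁, hC₁, M, hM, hpw⟩ := hΩ.exists_enorm_sub_average_le hn hs.le hsn b
  obtain ⟨C₂, hC₂, hker⟩ := exists_lintegral_rieszKernel_le hn hopen hfr hbdd hs hsn hq₁ hq₂ ha hb hM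
  obtain ⟨D, hD, hdD⟩ := exists_bdryDist_le hfr hbdd
  have hfin := isFiniteMeasure_distWeightMeasure ha hopen.measurableSet hbdd hdD
  refine ⟨x₀, ρ, hρ, hB, 2 * C₁ * C₂, by positivity, fun A hA hAB => ?_⟩
  set ν := distWeightMeasure Ω a with hν
  set B := closedBall x₀ ρ with hBdef
  set u : EuclideanSpace ℝ (Fin n) → ℝ := A.indicator 1 with hu
  have hum : Measurable u := measurable_one.indicator hA
  have hul : LocallyIntegrable u := by
    refine (locallyIntegrable_const (1 : ℝ)).mono hum.aestronglyMeasurable ?_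
    refine Eventually.of_forall fun x => ?_
    by_cases h : x ∈ A <;> simp [u, h]
  have hq : 0 < q := by linarith
  have hvB : 0 < volume.real B :=
    ENNReal.toReal_pos (measure_closedBall_pos _ _ hρ).ne' measure_closedBall_lt_top.ne
  have havg : ⨍ x in B, u x ≤ 1 / 2 := by
    rw [setAverage_eq, smul_eq_mul, integral_indicator_one hA, inv_mul_le_iff₀ hvB]
    have := ENNReal.toReal_mono (ENNReal.div_ne_top measure_closedBall_lt_top.ne two_ne_zero) hAB
    rw [ENNReal.toReal_div] at this
    simpa [Measure.real, div_eq_mul_inv] using this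
  set g : EuclideanSpace ℝ (Fin n) → ℝ≥0∞ := fun x =>
    ENNReal.ofReal (bdryDist Ω x ^ (-b)) * fracInner Ω s b u x with hg
  have hgm : Measurable g := by
    have := measurable_fracInner (Ω := Ω) s b hum
    have hd : Measurable (bdryDist Ω) := continuous_bdryDist.measurable
    fun_prop
  -- On `A` the function `u` is `1`, while its average over `B` is at most `1/2`.
  have hae : ∀ᵐ y ∂ν.restrict A, ENNReal.ofReal (1 / 2) ≤
      ENNReal.ofReal C₁ * ∫⁻ x in Ω, rieszKernel Ω s M x y * g x := by
    have hac : ν ≪ volume.restrict Ω := withDensity_absolutelyContinuous _ _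
    have h1 : ∀ᵐ y ∂ν, y ∈ Ω := hac.ae_le (ae_restrict_mem hopen.measurableSet)
    have h2 := hac.ae_le (ae_restrict_of_ae (s := Ω) (hpw u hum hul))
    filter_upwards [ae_restrict_of_ae h1, ae_restrict_of_ae h2, ae_restrict_mem hA]
      with y hy1 hy2 hyA
    refine le_trans ?_ (hy2 hy1)
    have hu1 : u y = 1 := by simp [u, hyA]
    rw [hu1, ← ofReal_norm]
    refine ENNReal.ofReal_le_ofReal ((le_abs_self _).trans' ?_)
    linarith
  have hmain : ENNReal.ofReal (1 / 2) * ν A ≤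
      ENNReal.ofReal (C₁ * C₂) * ν A ^ (1 - 1 / q) * fracSeminormOne Ω s b u := by
    have hkm := measurable_rieszKernel (Ω := Ω) s M
    have hpt : ∀ x ∈ Ω, (∫⁻ y in A, rieszKernel Ω s M x y ∂ν) * g x ≤
        ENNReal.ofReal C₂ * ν A ^ (1 - 1 / q) * fracInner Ω s b u x := by
      intro x hx
      have hd0 := bdryDist_pos hopen hfr hx
      calc (∫⁻ y in A, rieszKernel Ω s M x y ∂ν) * g x
          ≤ (ENNReal.ofReal C₂ * (ν A ^ (1 - 1 / q) * ENNReal.ofReal (bdryDist Ω x ^ b))) * g x :=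
            mul_le_mul' (hker x hx A hA) le_rfl
        _ = ENNReal.ofReal C₂ * ν A ^ (1 - 1 / q) * (ENNReal.ofReal (bdryDist Ω x ^ b) *
              ENNReal.ofReal (bdryDist Ω x ^ (-b))) * fracInner Ω s b u x := by
            simp only [hg]
            ring
        _ = _ := by
            rw [← ENNReal.ofReal_mul (by positivity), ← Real.rpow_add hd0]
            simp
    calc ENNReal.ofReal (1 / 2) * ν A = ∫⁻ _ in A, ENNReal.ofReal (1 / 2) ∂ν :=
          (setLIntegral_const _ _).symm
      _ ≤ ∫⁻ y in A, (ENNReal.ofReal C₁ * ∫⁻ x in Ω, rieszKernel Ω s M x y * g x) ∂ν :=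
          lintegral_mono_ae hae
      _ = ENNReal.ofReal C₁ * ∫⁻ x in Ω, (∫⁻ y in A, rieszKernel Ω s M x y ∂ν) * g x := by
          rw [lintegral_const_mul' _ _ ENNReal.ofReal_ne_top,
            lintegral_lintegral_mul_swap _ _ hkm hgm]
      _ ≤ ENNReal.ofReal C₁ * ∫⁻ x in Ω,
            ENNReal.ofReal C₂ * ν A ^ (1 - 1 / q) * fracInner Ω s b u x :=
          mul_le_mul' le_rfl (setLIntegral_mono' hopen.measurableSet hpt)
      _ = _ := by
          rw [lintegral_const_mul _ (measurable_fracInner s b hum),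
            fracSeminormOne_eq_lintegral_fracInner, ENNReal.ofReal_mul hC₁.le]
          ring
  rcases eq_or_ne (ν A) 0 with h0 | h0
  · rw [h0, ENNReal.zero_rpow_of_pos (by positivity)]
    exact zero_le
  have hAtop : ν A ≠ ⊤ := measure_ne_top _ _
  have hp0 : ν A ^ (1 - 1 / q) ≠ 0 := (ENNReal.rpow_pos (pos_iff_ne_zero.2 h0) hAtop).ne'
  have hpt : ν A ^ (1 - 1 / q) ≠ ⊤ :=
    ENNReal.rpow_ne_top_of_nonneg (by rw [sub_nonneg, div_le_one hq]; exact hq₁) hAtop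
  rw [← ENNReal.mul_le_mul_iff_right hp0 hpt, ← ENNReal.rpow_add _ _ h0 hAtop, sub_add_cancel,
    ENNReal.rpow_one]
  calc ν A = ENNReal.ofReal 2 * (ENNReal.ofReal (1 / 2) * ν A) := by
        rw [← mul_assoc, ← ENNReal.ofReal_mul (by norm_num)]
        norm_num
    _ ≤ ENNReal.ofReal 2 *
          (ENNReal.ofReal (C₁ * C₂) * ν A ^ (1 - 1 / q) * fracSeminormOne Ω s b u) := by
        gcongr
    _ = _ := by
        rw [mul_assoc 2, ENNReal.ofReal_mul (p := 2) (by norm_num)]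
        ring

end Isoperimetric

/-! ### From sets to functions -/

section Coarea

variable {n : ℕ} {Ω : Set (EuclideanSpace ℝ (Fin n))}

lemma fracSeminormOne_congr (hopen : IsOpen Ω) (hfr : (frontier Ω).Nonempty) (s b : ℝ)
    {f g : EuclideanSpace ℝ (Fin n) → ℝ} (h : EqOn f g Ω) :
    fracSeminormOne Ω s b f = fracSeminormOne Ω s b g := by
  refine setLIntegral_congr_fun hopen.measurableSet fun x hx => ?_
  refine setLIntegral_congr_fun measurableSet_closedBall fun z hz => ?_
  have hd := bdryDist_pos hopen hfr hx
  have hz' : dist z x ≤ bdryDist Ω x / 2 := hz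
  simp only [h hx, h (mem_of_dist_lt_bdryDist hopen hx (hz'.trans_lt (by linarith)))]

lemma fracSeminormOne_neg (s b : ℝ) (f : EuclideanSpace ℝ (Fin n) → ℝ) :
    fracSeminormOne Ω s b (fun x => -f x) = fracSeminormOne Ω s b f := by
  refine lintegral_congr fun x => lintegral_congr fun z => ?_
  rw [← abs_neg (-f z - -f x)]
  congr 4
  ring

lemma fracSeminormOne_eq_lintegral_prod (s b : ℝ) {f : EuclideanSpace ℝ (Fin n) → ℝ}
    (hf : Measurable f) :
    fracSeminormOne Ω s b f = ∫⁻ p, ‖f p.2 - f p.1‖ₑ *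
      {p : EuclideanSpace ℝ (Fin n) × EuclideanSpace ℝ (Fin n) |
        dist p.2 p.1 ≤ bdryDist Ω p.1 / 2}.indicator
        (fun p => fracKernel Ω s b p.1 p.2) p ∂((volume.restrict Ω).prod volume) := by
  have hk := (measurable_fracKernel (Ω := Ω) s b).indicator
    (measurableSet_dist_le_bdryDist (Ω := Ω))
  rw [lintegral_prod _ (by fun_prop), fracSeminormOne_eq_lintegral_fracInner]
  refine lintegral_congr fun x => ?_
  rw [fracInner_eq_lintegral_indicator]
  refine lintegral_congr fun z => ?_
  simp only [indicator]
  split_ifs <;> simp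

/-- The coarea formula for the fractional seminorm. -/
lemma lintegral_fracSeminormOne_superlevel (s b : ℝ) {f : EuclideanSpace ℝ (Fin n) → ℝ}
    (hf : Measurable f) :
    ∫⁻ t : ℝ, fracSeminormOne Ω s b ({x | t < f x}.indicator 1) = fracSeminormOne Ω s b f := by
  have hk := (measurable_fracKernel (Ω := Ω) s b).indicator
    (measurableSet_dist_le_bdryDist (Ω := Ω))
  have hm (t : ℝ) : Measurable ({x | t < f x}.indicator (1 : EuclideanSpace ℝ (Fin n) → ℝ)) :=
    measurable_one.indicator (measurableSet_lt measurable_const hf)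
  simp_rw [fun t => fracSeminormOne_eq_lintegral_prod (Ω := Ω) s b (hm t)]
  have hjoint : Measurable fun p : ℝ × EuclideanSpace ℝ (Fin n) =>
      {x | p.1 < f x}.indicator (1 : EuclideanSpace ℝ (Fin n) → ℝ) p.2 :=
    (measurable_const (a := (1 : ℝ))).indicator
      (s := {p : ℝ × EuclideanSpace ℝ (Fin n) | p.1 < f p.2})
      (measurableSet_lt (by fun_prop) (by fun_prop))
  rw [lintegral_lintegral_swap, fracSeminormOne_eq_lintegral_prod s b hf]
  · refine lintegral_congr fun p => ?_
    rw [lintegral_mul_const', ← lintegral_enorm_indicator_Ioi_sub]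
    · rfl
    · simp only [indicator]
      split_ifs
      · exact ENNReal.ofReal_ne_top
      · exact ENNReal.zero_ne_top
  · have h1 : Measurable fun p : ℝ × EuclideanSpace ℝ (Fin n) × EuclideanSpace ℝ (Fin n) =>
        {x | p.1 < f x}.indicator (1 : EuclideanSpace ℝ (Fin n) → ℝ) p.2.2 :=
      hjoint.comp (f := fun p : ℝ × EuclideanSpace ℝ (Fin n) × EuclideanSpace ℝ (Fin n) =>
        (p.1, p.2.2)) (by fun_prop)
    have h2 : Measurable fun p : ℝ × EuclideanSpace ℝ (Fin n) × EuclideanSpace ℝ (Fin n) =>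
        {x | p.1 < f x}.indicator (1 : EuclideanSpace ℝ (Fin n) → ℝ) p.2.1 :=
      hjoint.comp (f := fun p : ℝ × EuclideanSpace ℝ (Fin n) × EuclideanSpace ℝ (Fin n) =>
        (p.1, p.2.1)) (by fun_prop)
    exact ((h1.sub h2).enorm.mul (hk.comp measurable_snd)).aemeasurable

/-- For `t > 0` the set `{f > t + c}` lies in `{f > c}`, so the isoperimetric hypothesis applies at
every level; the coarea formula sums the results. -/
lemma lintegral_posPart_rpow_le {s q a b C : ℝ} (hq : 1 ≤ q) {B : Set (EuclideanSpace ℝ (Fin n))}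
    [IsFiniteMeasure (distWeightMeasure Ω a)]
    (hiso : ∀ A : Set (EuclideanSpace ℝ (Fin n)), MeasurableSet A →
        volume.restrict B A ≤ volume B / 2 →
        distWeightMeasure Ω a A ^ (1 / q) ≤
          ENNReal.ofReal C * fracSeminormOne Ω s b (A.indicator 1))
    {f : EuclideanSpace ℝ (Fin n) → ℝ} (hf : Measurable f) {c : ℝ}
    (hc : volume.restrict B {x | c < f x} ≤ volume B / 2) :
    (∫⁻ x, ENNReal.ofReal (f x - c) ^ q ∂(distWeightMeasure Ω a)) ^ (1 / q) ≤
      ENNReal.ofReal C * fracSeminormOne Ω s b f := by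
  have hlev : ∀ t ∈ Ioi (0 : ℝ), distWeightMeasure Ω a {x | t < f x - c} ^ (1 / q) ≤
      ENNReal.ofReal C * fracSeminormOne Ω s b ({x | t + c < f x}.indicator 1) := by
    intro t ht
    have hset : {x | t < f x - c} = {x | t + c < f x} := by
      ext x
      simp only [mem_ofPred_eq, lt_sub_iff_add_lt]
    rw [hset]
    refine hiso _ (measurableSet_lt measurable_const hf) ((measure_mono fun x hx => ?_).trans hc)
    have h1 : t + c < f x := hx
    have h2 : 0 < t := ht
    show c < f x
    linarith
  calc (∫⁻ x, ENNReal.ofReal (f x - c) ^ q ∂(distWeightMeasure Ω a)) ^ (1 / q)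
      ≤ ∫⁻ t in Ioi (0 : ℝ), distWeightMeasure Ω a {x | t < f x - c} ^ (1 / q) :=
        lintegral_rpow_le_lintegral_meas_rpow _ hq (hf.sub_const c)
    _ ≤ ∫⁻ t in Ioi (0 : ℝ),
          ENNReal.ofReal C * fracSeminormOne Ω s b ({x | t + c < f x}.indicator 1) :=
        setLIntegral_mono' measurableSet_Ioi hlev
    _ ≤ ∫⁻ t : ℝ, ENNReal.ofReal C * fracSeminormOne Ω s b ({x | t + c < f x}.indicator 1) :=
        setLIntegral_le_lintegral _ _
    _ = ENNReal.ofReal C * fracSeminormOne Ω s b f := by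
        rw [lintegral_const_mul' _ _ ENNReal.ofReal_ne_top, lintegral_add_right_eq_self
          (fun t => fracSeminormOne Ω s b ({x | t < f x}.indicator 1)) c,
          lintegral_fracSeminormOne_superlevel s b hf]

end Coarea

/-! ### The Poincaré inequality -/

theorem mainTheorem3 (n : ℕ) (hn : 2 ≤ n) (Ω : Set (EuclideanSpace ℝ (Fin n)))
    (hΩ : IsJohnDomain Ω) (s q a b : ℝ) (hs : s ∈ Ioo (0 : ℝ) 1)
    (hq₁ : 1 ≤ q) (hq₂ : q ≤ (n : ℝ) / ((n : ℝ) - s)) (ha : 0 ≤ a)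
    (hb : b ≤ ((n : ℝ) + a) / q - (n : ℝ) + s) :
    ∃ C : ℝ, 0 < C ∧ ∀ f : EuclideanSpace ℝ (Fin n) → ℝ, ContDiffOn ℝ ∞ f Ω →
      (⨅ c : ℝ, eLpNorm (fun y => f y - c) (ENNReal.ofReal q) (distWeightMeasure Ω a)) ≤
        ENNReal.ofReal C * fracSeminormOne Ω s b f := by
  have hn1 : 1 ≤ n := by lia
  have hn2 : (2 : ℝ) ≤ n := by exact_mod_cast hn
  have hq : 0 < q := by linarith
  have hopen := hΩ.isOpen
  have hbdd := hΩ.isBounded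
  have hfr := frontier_nonempty_of_isBounded hn1 hΩ.isConnected.nonempty hbdd
  obtain ⟨D, hD, hdD⟩ := exists_bdryDist_le hfr hbdd
  have hfin := isFiniteMeasure_distWeightMeasure ha hopen.measurableSet hbdd hdD
  obtain ⟨x₀, ρ, hρ, hB, C, hC, hiso⟩ := hΩ.exists_measure_rpow_le_fracSeminormOne hn1 hs.1
    (by linarith [hs.2]) hq₁ hq₂ ha hb
  refine ⟨2 * C, by positivity, fun f hf => ?_⟩
  set ν := distWeightMeasure Ω a with hν
  -- Off `Ω` nothing is known about `f`; the extension by zero is globally measurable and has the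
  -- same seminorm.
  set F : EuclideanSpace ℝ (Fin n) → ℝ := Ω.indicator f with hF
  have hFf : EqOn F f Ω := fun x hx => indicator_of_mem hx f
  have hFm : Measurable F := by
    classical
    rw [hF, ← piecewise_eq_indicator]
    exact hf.continuousOn.measurable_piecewise continuousOn_const hopen.measurableSet
  -- The median is taken on a compact ball inside `Ω`, where `f` is bounded; on all of `Ω` it need
  -- not be.
  have hfB : Bornology.IsBounded (f '' closedBall x₀ ρ) :=
    ((isCompact_closedBall x₀ ρ).image_of_continuousOn (hf.continuousOn.mono hB)).isBounded
  obtain ⟨m, hm⟩ := hfB.exists_norm_le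
  have hmB : ∀ᵐ x ∂volume.restrict (closedBall x₀ ρ), |F x| ≤ m := by
    filter_upwards [ae_restrict_mem measurableSet_closedBall] with x hx
    rw [hFf (hB hx)]
    exact hm _ (mem_image_of_mem f hx)
  have hfinB : IsFiniteMeasure (volume.restrict (closedBall x₀ ρ)) :=
    ⟨by rw [Measure.restrict_apply_univ]; exact measure_closedBall_lt_top⟩
  have hB0 : volume.restrict (closedBall x₀ ρ) ≠ 0 := by
    rw [Ne, Measure.restrict_eq_zero]
    exact (measure_closedBall_pos _ _ hρ).ne'
  obtain ⟨c, hc1, hc2⟩ := exists_median _ hB0 hFm hmB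
  rw [Measure.restrict_apply_univ] at hc1 hc2
  have hpos := lintegral_posPart_rpow_le hq₁ hiso hFm hc1
  have hneg := lintegral_posPart_rpow_le hq₁ hiso hFm.neg (c := -c)
    (by simpa only [Pi.neg_apply, neg_lt_neg_iff] using hc2)
  have hSneg : fracSeminormOne Ω s b (-F) = fracSeminormOne Ω s b F := fracSeminormOne_neg s b F
  have hSF : fracSeminormOne Ω s b F = fracSeminormOne Ω s b f :=
    fracSeminormOne_congr hopen hfr s b hFf
  rw [hSneg, hSF] at hneg
  rw [hSF] at hpos
  have hae : ∀ᵐ x ∂ν, x ∈ Ω :=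
    (withDensity_absolutelyContinuous _ _).ae_le (ae_restrict_mem hopen.measurableSet)
  refine (iInf_le _ c).trans ?_
  rw [eLpNorm_eq_lintegral_rpow_enorm_toReal (ENNReal.ofReal_pos.2 hq).ne' ENNReal.ofReal_ne_top,
    ENNReal.toReal_ofReal hq.le]
  calc (∫⁻ x, ‖f x - c‖ₑ ^ q ∂ν) ^ (1 / q)
      ≤ (∫⁻ x, ((fun x => ENNReal.ofReal (F x - c)) + fun x => ENNReal.ofReal ((-F) x - -c)) x ^ q
          ∂ν) ^ (1 / q) := by
        refine ENNReal.rpow_le_rpow (lintegral_mono_ae ?_) (by positivity)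
        filter_upwards [hae] with x hx
        refine ENNReal.rpow_le_rpow ?_ hq.le
        rw [Pi.add_apply, Pi.neg_apply, hFf hx, ← ofReal_norm, Real.norm_eq_abs]
        rcases le_total 0 (f x - c) with h | h
        · rw [abs_of_nonneg h]
          exact le_self_add
        · rw [abs_of_nonpos h]
          refine le_trans (le_of_eq ?_) le_add_self
          congr 1
          ring
    _ ≤ (∫⁻ x, ENNReal.ofReal (F x - c) ^ q ∂ν) ^ (1 / q) +
          (∫⁻ x, ENNReal.ofReal ((-F) x - -c) ^ q ∂ν) ^ (1 / q) := by
        have h1 : AEMeasurable (fun x => ENNReal.ofReal (F x - c)) ν :=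
          (hFm.sub_const c).ennreal_ofReal.aemeasurable
        have h2 : AEMeasurable (fun x => ENNReal.ofReal ((-F) x - -c)) ν :=
          (hFm.neg.sub_const (-c)).ennreal_ofReal.aemeasurable
        exact ENNReal.lintegral_Lp_add_le h1 h2 hq₁
    _ ≤ ENNReal.ofReal C * fracSeminormOne Ω s b f + ENNReal.ofReal C * fracSeminormOne Ω s b f :=
        add_le_add hpos hneg
    _ = ENNReal.ofReal (2 * C) * fracSeminormOne Ω s b f := by
        rw [ENNReal.ofReal_mul (by norm_num), ENNReal.ofReal_ofNat]
        ring
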